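/- Let $n,m\ge 0$ be integers and let $P=(p_{i,j})$ be an $n\times m$ matrix of nonnegative rational numbers with $\sum_{j=1}^m p_{i,j}=1$ for every $i$. There are $n$ independent tuples; tuple $i$ takes group $j$ with probability $p_{i,j}$, so a possible world $w:\{1,\dots,n\}\to\{1,\dots,m\}$ has probability $\prod_i p_{i,w(i)}$. The answer of the group-by count query in $w$ is the vector $\mathbf r\in\mathbb Z_{\ge0}^m$ with $\mathbf r[j]=|\{i: w(i)=j\}|$; a vector is a possible answer if it is the answer with nonzero probability. Let $\bar{\mathbf r}=\mathsf E[\mathbf r]$ be the mean answer, i.e. $\bar{\mathbf r}[j]=\sum_i p_{i,j}$. Call a possible answer $\mathbf r^*$ closest if $\|\mathbf r^*-\bar{\mathbf r}\|_2^2\le\|\mathbf r-\bar{\mathbf r}\|_2^2$ for all possible answers $\mathbf r$. **Theorem.** (1) There is a polynomial-time algorithm that, given $n$, $m$ and $P$, outputs a closest possible answer $\mathbf r^*$. Precisely: there are one program for the random access machine with logarithmic (bit) cost and one polynomial $q$ such that on every input the program halts at cost at most $q(N)$ with a closest possible answer as its output, where $N$ is $n+m$ plus the total binary length of the numerators and denominators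 (in lowest terms) of all $p_{i,j}$. (2) Consider the network with a source $s$, a sink $t$, a vertex $u_i$ for each tuple and a vertex $v_j$ for each group, and the following edges: $(s,u_i)$ with capacity bounds $0$ and $1$; $(u_i,v_j)$ with bounds $0$ and $1$ whenever $p_{i,j}\neq0$; $e_1(v_j,t)$ with both bounds equal to $\lfloor\bar{\mathbf r}[j]\rfloor$; and, if $\bar{\mathbf r}[j]$ is not an integer, $e_2(v_j,t)$ with bounds $0$ and $1$ and cost $(\lceil\bar{\mathbf r}[j]\rceil-\bar{\mathbf r}[j])^2-(\lfloor\bar{\mathbf r}[j]\rfloor-\bar{\mathbf r}[j])^2$; all other edges have cost $0$. Then a vector $\mathbf r^*$ is a closest possible answer if and only if there is a minimum-cost integral flow of value $n$ in this network such that, for every $j$, $\mathbf r^*[j]=\lceil\bar{\mathbf r}[j]\rceil$ if $e_2(v_j,t)$ exists and is saturated and $\mathbf r^*[j]=\lfloor\bar{\mathbf r}[j]\rfloor$ otherwise. -/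

import Mathlib

/-! ## A random access machine with logarithmic cost -/

namespace RAM

/-- A memory: numbered arrays of natural-number registers; `σ a i` is the content of register `i`
of array `a`. The arrays are named by constants in a program, so that a program uses only finitely
many of them. A scalar variable is register `0` of some array. -/
abbrev State := ℕ → ℕ → ℕ

/-- Arithmetic expressions. `get a i` is the register of array `a` whose index is the value of `i`
(indirect addressing). Subtraction is truncated and division is rounded down, with `x / 0 = 0`. -/
inductive Expr where
  | const (k : ℕ)
  | get (a : ℕ) (i : Expr)
  | add (x y : Expr)
  | sub (x y : Expr)
  | mul (x y : Expr)
  | div (x y : Expr)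

/-- The value of an expression. -/
def Expr.eval (σ : State) : Expr → ℕ
  | .const k => k
  | .get a i => σ a (i.eval σ)
  | .add x y => x.eval σ + y.eval σ
  | .sub x y => x.eval σ - y.eval σ
  | .mul x y => x.eval σ * y.eval σ
  | .div x y => x.eval σ / y.eval σ

/-- The number of bit operations charged for evaluating an expression: every operation pays for
the binary length (`Nat.size`) of its operands and, for a memory access, of the address and of the
content; multiplication and division pay the schoolbook product of the lengths. -/
def Expr.cost (σ : State) : Expr → ℕ
  | .const k => k.size + 1
  | .get a i => i.cost σ + (i.eval σ).size + (σ a (i.eval σ)).size + 1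
  | .add x y => x.cost σ + y.cost σ + (x.eval σ).size + (y.eval σ).size + 1
  | .sub x y => x.cost σ + y.cost σ + (x.eval σ).size + (y.eval σ).size + 1
  | .mul x y => x.cost σ + y.cost σ + ((x.eval σ).size + 1) * ((y.eval σ).size + 1)
  | .div x y => x.cost σ + y.cost σ + ((x.eval σ).size + 1) * ((y.eval σ).size + 1)

/-- Programs. `store a i e` performs `a[i] := e`; a test succeeds if its value is not zero. -/
inductive Cmd where
  | skip
  | store (a : ℕ) (i e : Expr)
  | seq (c d : Cmd)
  | ite (b : Expr) (c d : Cmd)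
  | loop (b : Expr) (c : Cmd)

/-- The memory after writing `v` into register `i` of array `a`. -/
def State.set (σ : State) (a i v : ℕ) : State :=
  Function.update σ a (Function.update (σ a) i v)

/-- `Exec c σ τ t`: started in memory `σ`, the program `c` halts in memory `τ` at total cost `t`. -/
inductive Exec : Cmd → State → State → ℕ → Prop
  | skip (σ : State) : Exec .skip σ σ 1
  | store (σ : State) (a : ℕ) (i e : Expr) :
      Exec (.store a i e) σ (σ.set a (i.eval σ) (e.eval σ))
        (i.cost σ + e.cost σ + (i.eval σ).size + (e.eval σ).size + 1)
  | seq {c d : Cmd} {σ τ υ : State} {s t : ℕ} (hc : Exec c σ τ s) (hd : Exec d τ υ t) :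
      Exec (.seq c d) σ υ (s + t)
  | ite_true {b : Expr} {c d : Cmd} {σ τ : State} {t : ℕ} (hb : b.eval σ ≠ 0)
      (hc : Exec c σ τ t) : Exec (.ite b c d) σ τ (b.cost σ + (b.eval σ).size + 1 + t)
  | ite_false {b : Expr} {c d : Cmd} {σ τ : State} {t : ℕ} (hb : b.eval σ = 0)
      (hd : Exec d σ τ t) : Exec (.ite b c d) σ τ (b.cost σ + (b.eval σ).size + 1 + t)
  | loop_true {b : Expr} {c : Cmd} {σ τ υ : State} {s t : ℕ} (hb : b.eval σ ≠ 0)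
      (hc : Exec c σ τ s) (hl : Exec (.loop b c) τ υ t) :
      Exec (.loop b c) σ υ (b.cost σ + (b.eval σ).size + 1 + s + t)
  | loop_false {b : Expr} {c : Cmd} {σ : State} (hb : b.eval σ = 0) :
      Exec (.loop b c) σ σ (b.cost σ + (b.eval σ).size + 1)

/-- Execution is deterministic: the memory at the end and the cost are determined by the program
and the memory at the start. -/
theorem Exec.deterministic {c : Cmd} {σ τ : State} {t : ℕ} (h : Exec c σ τ t) :
    ∀ {τ' : State} {t' : ℕ}, Exec c σ τ' t' → τ = τ' ∧ t = t' := by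
  induction h with
  | skip σ => intro τ' t' h'; cases h'; exact ⟨rfl, rfl⟩
  | store σ a i e => intro τ' t' h'; cases h'; exact ⟨rfl, rfl⟩
  | seq _ _ ihc ihd =>
    intro τ' t' h'
    cases h' with
    | seq hc hd =>
      obtain ⟨rfl, rfl⟩ := ihc hc
      obtain ⟨rfl, rfl⟩ := ihd hd
      exact ⟨rfl, rfl⟩
  | ite_true hb _ ih =>
    intro τ' t' h'
    cases h' with
    | ite_true _ hc => obtain ⟨rfl, rfl⟩ := ih hc; exact ⟨rfl, rfl⟩
    | ite_false hb' _ => exact absurd hb' hb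
  | ite_false hb _ ih =>
    intro τ' t' h'
    cases h' with
    | ite_true hb' _ => exact absurd hb hb'
    | ite_false _ hc => obtain ⟨rfl, rfl⟩ := ih hc; exact ⟨rfl, rfl⟩
  | loop_true hb _ _ ihc ihl =>
    intro τ' t' h'
    cases h' with
    | loop_true _ hc hl =>
      obtain ⟨rfl, rfl⟩ := ihc hc
      obtain ⟨rfl, rfl⟩ := ihl hl
      exact ⟨rfl, rfl⟩
    | loop_false hb' => exact absurd hb' hb
  | loop_false hb =>
    intro τ' t' h'
    cases h' with
    | loop_true hb' _ _ => exact absurd hb hb'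
    | loop_false _ => exact ⟨rfl, rfl⟩

end RAM

/-! ## Flow networks with lower and upper capacities -/

/-- A directed multigraph with lower and upper capacities and costs on its edges, a source and a
sink. -/
structure FlowNetwork (V E : Type) where
  src : E → V
  dst : E → V
  lower : E → ℕ
  upper : E → ℕ
  cost : E → ℚ
  source : V
  sink : V

namespace FlowNetwork

variable {V E : Type} [DecidableEq V] [Fintype E]

/-- `f` is an integral flow of value `k`: it respects both capacities, is conserved at every vertex
other than the source and the sink, and its net outflow at the source is `k`. -/
def IsFlow (N : FlowNetwork V E) (k : ℕ) (f : E → ℕ) : Prop :=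
  (∀ e, N.lower e ≤ f e ∧ f e ≤ N.upper e) ∧
  (∀ v, v ≠ N.source → v ≠ N.sink →
    ∑ e with N.dst e = v, f e = ∑ e with N.src e = v, f e) ∧
  ∑ e with N.src e = N.source, f e = ∑ e with N.dst e = N.source, f e + k

/-- The total cost of `f`. -/
def flowCost (N : FlowNetwork V E) (f : E → ℕ) : ℚ := ∑ e, N.cost e * f e

/-- `f` is a minimum-cost integral flow of value `k`. -/
def IsMinCostFlow (N : FlowNetwork V E) (k : ℕ) (f : E → ℕ) : Prop :=
  N.IsFlow k f ∧ ∀ g, N.IsFlow k g → N.flowCost f ≤ N.flowCost g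

end FlowNetwork

/-! ## Group-by count queries over independent tuples with attribute uncertainty -/

/-- `n` independent tuples and `m` potential groups; tuple `i` takes group `j` with probability
`p i j`. -/
structure ProbTable (n m : ℕ) where
  p : Matrix (Fin n) (Fin m) ℚ
  nonneg : ∀ i j, 0 ≤ p i j
  row_sum : ∀ i, ∑ j, p i j = 1

namespace ProbTable

variable {n m : ℕ} (T : ProbTable n m)

/-- The probability of the possible world in which every tuple `i` takes the group `w i`. -/
def worldProb (w : Fin n → Fin m) : ℚ := ∏ i, T.p i (w i)

/-- The answer of the query in the world `w`: the number of tuples in each group. -/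
def answer (w : Fin n → Fin m) (j : Fin m) : ℕ := Fintype.card {i // w i = j}

/-- The probability that the answer is `r`. -/
def answerProb (r : Fin m → ℕ) : ℚ := ∑ w with answer w = r, T.worldProb w

/-- `r` is the answer with nonzero probability. -/
def IsPossible (r : Fin m → ℕ) : Prop := T.answerProb r ≠ 0

/-- The mean answer: the expectation of the random answer, coordinate by coordinate. -/
def mean (j : Fin m) : ℚ := ∑ w, T.worldProb w * answer w j

/-- The mean answer is the vector of column sums of the matrix `p`. -/
theorem mean_eq_column_sum (j : Fin m) : T.mean j = ∑ i, T.p i j := by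
  have key : ∀ k : Fin n, ∑ w : Fin n → Fin m, T.worldProb w * (if w k = j then 1 else 0)
      = T.p k j := by
    intro k
    have h := Finset.prod_univ_sum (fun _ : Fin n => (Finset.univ : Finset (Fin m)))
      (fun i l => T.p i l * (if i = k then (if l = j then 1 else 0) else 1))
    rw [Fintype.piFinset_univ] at h
    have h1 : ∀ w : Fin n → Fin m,
        ∏ i, (T.p i (w i) * (if i = k then (if w i = j then 1 else 0) else 1))
          = T.worldProb w * (if w k = j then 1 else 0) := by
      intro w
      rw [Finset.prod_mul_distrib, Finset.prod_ite_eq' Finset.univ k]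
      simp [worldProb]
    rw [← Finset.sum_congr rfl (fun w _ => h1 w), ← h, Finset.prod_eq_single k]
    · simp
    · intro i _ hi
      simp [hi, T.row_sum]
    · simp
  unfold mean
  have h2 : ∀ w : Fin n → Fin m, (answer w j : ℚ) = ∑ i, if w i = j then (1 : ℚ) else 0 := by
    intro w
    simp [answer, Fintype.card_subtype]
  simp_rw [h2, Finset.mul_sum]
  rw [Finset.sum_comm]
  exact Finset.sum_congr rfl (fun k _ => key k)

/-- The squared Euclidean distance of `r` from the mean answer. -/
def sqDistMean (r : Fin m → ℕ) : ℚ := ∑ j, ((r j : ℚ) - T.mean j) ^ 2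

/-- `r` is a possible answer, and no possible answer is closer to the mean answer. -/
def IsClosestPossible (r : Fin m → ℕ) : Prop :=
  T.IsPossible r ∧ ∀ r', T.IsPossible r' → T.sqDistMean r ≤ T.sqDistMean r'

/-! ### Input and output of algorithms -/

/-- The memory that holds the table: `n` and `m` in registers `0` and `1` of array `0`, and the
numerator and the denominator (in lowest terms) of `p i j` in register `i * m + j` of the arrays `1`
and `2`; all other registers hold `0`. -/
def input : RAM.State := fun a x =>
  if a = 0 then (if x = 0 then n else if x = 1 then m else 0)
  else if a = 1 then
    ∑ i : Fin n, ∑ j : Fin m, if x = i * m + j then (T.p i j).num.toNat else 0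
  else if a = 2 then
    ∑ i : Fin n, ∑ j : Fin m, if x = i * m + j then (T.p i j).den else 0
  else 0

/-- The size of the table: `n + m` plus the binary lengths of all numerators and denominators. -/
def size : ℕ :=
  n + m + ∑ i, ∑ j, ((T.p i j).num.toNat.size + (T.p i j).den.size)

/-- The vector in the first `m` registers of array `3`, where an algorithm leaves its result. -/
def output (m : ℕ) (σ : RAM.State) : Fin m → ℕ := fun j => σ 3 j

/-! ### The network -/

/-- The vertices: a source, the tuples, the groups and a sink. -/
inductive Node (n m : ℕ) where
  | source
  | tuple (i : Fin n)
  | group (j : Fin m)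
  | sink
  deriving DecidableEq

/-- The edges, in this order: one from the source to each tuple; one from tuple `i` to group `j`
whenever `i` takes `j` with nonzero probability; one base edge from each group to the sink; and
one extra edge from each group with nonintegral mean count to the sink. -/
abbrev Edge : Type :=
  Fin n ⊕ {x : Fin n × Fin m // T.p x.1 x.2 ≠ 0} ⊕ Fin m ⊕
    {j : Fin m // (⌊T.mean j⌋₊ : ℚ) ≠ T.mean j}

/-- The network: the base edge at group `j` must carry exactly `⌊mean j⌋`, all other edges have
capacity `1`, and only the extra edges have a cost. -/
def network : FlowNetwork (Node n m) T.Edge where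
  src
    | .inl _ => .source
    | .inr (.inl x) => .tuple x.1.1
    | .inr (.inr (.inl j)) => .group j
    | .inr (.inr (.inr j)) => .group j.1
  dst
    | .inl i => .tuple i
    | .inr (.inl x) => .group x.1.2
    | .inr (.inr _) => .sink
  lower
    | .inr (.inr (.inl j)) => ⌊T.mean j⌋₊
    | _ => 0
  upper
    | .inr (.inr (.inl j)) => ⌊T.mean j⌋₊
    | _ => 1
  cost
    | .inr (.inr (.inr j)) =>
        ((⌈T.mean j.1⌉₊ : ℚ) - T.mean j.1) ^ 2 - ((⌊T.mean j.1⌋₊ : ℚ) - T.mean j.1) ^ 2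
    | _ => 0
  source := .source
  sink := .sink

/-- The vector read off a flow: the mean count is rounded up at the groups whose extra edge is
saturated, and rounded down at all other groups. -/
def readOff (f : T.Edge → ℕ) (j : Fin m) : ℕ :=
  if ∃ h : (⌊T.mean j⌋₊ : ℚ) ≠ T.mean j, f (.inr (.inr (.inr ⟨j, h⟩))) = 1
  then ⌈T.mean j⌉₊ else ⌊T.mean j⌋₊

end ProbTable

/-! Let a be the answer of a world that uses only entries of nonzero probability, and μ the mean.
Draw an arc from group u to group v when some tuple sitting in u may also take v. Shifting tuples
along a shortest path from j to k transfers one unit of the count from j to k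
(`exists_exchange_of_path`). For j ≠ k this brings the answer closer to μ exactly when a_k + 1 - μ_k
< a_j - μ_j.

A world without an improving exchange is already globally optimal
(`LocallyOptimal.isClosestPossible`). The largest a_j - μ_j over all j that reach v is a node
potential π_v. It does not decrease when tuples pass to their groups in any other possible world,
and 2π_v - 1 lies between the two discrete slopes of the squared deviation at a_v, so it serves as a
dual certificate.

At such an optimum every count differs from its mean by less than one (`LocallyOptimal.answer_lt`,
`LocallyOptimal.lt_answer`). If a_j ≥ μ_j + 1, the groups reachable from j would hold more tuples
than their expected mass, although all the probability of those tuples stays inside. So closest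
answers only round μ up or down and come from flows in the network. Conversely, integral flows of
value n are worlds, and flow cost is squared distance minus a constant. This gives the second claim.

The first claim is proved by local search on exchanges. The squared distance may shrink by tiny
amounts, so progress is measured by ranks: each unit of each group is ranked by its marginal cost
among at most n * m units, and an improving exchange lowers the sum of the ranks of the units in use
(`potential_lt`). That sum is at most n * (n * m) (`potential_le`), whatever the denominators. The
program is written with counted loops bounded by n and m, in which each store lengthens numbers only
additively; `exec_compile` converts this into a polynomial bit cost. -/

namespace ProbTable

open Relation

variable {n m : ℕ} (T : ProbTable n m)

/-! ### Possible worlds and their answers -/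

/-- Every tuple takes in `w` a group that it takes with nonzero probability. -/
def Supported (w : Fin n → Fin m) : Prop := ∀ i, T.p i (w i) ≠ 0

theorem worldProb_nonneg (w : Fin n → Fin m) : 0 ≤ T.worldProb w :=
  Finset.prod_nonneg fun i _ => T.nonneg i (w i)

theorem worldProb_ne_zero_iff (w : Fin n → Fin m) : T.worldProb w ≠ 0 ↔ T.Supported w := by
  simp [worldProb, Supported, Finset.prod_ne_zero_iff]

/-- World probabilities are nonnegative, so they cannot cancel in the sum. -/
theorem isPossible_iff (r : Fin m → ℕ) :
    T.IsPossible r ↔ ∃ w, T.Supported w ∧ answer w = r := by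
  unfold IsPossible answerProb
  rw [Ne, Finset.sum_eq_zero_iff_of_nonneg fun w _ => T.worldProb_nonneg w]
  push Not
  simp only [Finset.mem_filter, Finset.mem_univ, true_and, worldProb_ne_zero_iff]
  exact exists_congr fun w => and_comm

theorem exists_ne_zero (i : Fin n) : ∃ j, T.p i j ≠ 0 := by
  by_contra! h
  have := T.row_sum i
  simp [h] at this

/-- There are finitely many worlds, and at least one of nonzero probability. The minimizer later
supplies a flow to compare a minimum-cost flow with. -/
theorem exists_isClosestPossible : ∃ r, T.IsClosestPossible r := by
  choose w hw using T.exists_ne_zero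
  let S : Finset (Fin m → ℕ) := {w | T.Supported w}.toFinite.toFinset.image answer
  have hS : ∀ r, r ∈ S ↔ T.IsPossible r := by
    intro r
    simp [S, isPossible_iff]
  obtain ⟨r, hr, hmin⟩ := S.exists_min_image T.sqDistMean
    ⟨answer w, (hS _).2 ((T.isPossible_iff _).2 ⟨w, hw, rfl⟩)⟩
  exact ⟨r, (hS r).1 hr, fun r' hr' => hmin r' ((hS r').2 hr')⟩

theorem answer_eq_sum (w : Fin n → Fin m) (j : Fin m) :
    answer w j = ∑ i, if w i = j then 1 else 0 := by
  simp [answer, Fintype.card_subtype]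

theorem answer_update (w : Fin n → Fin m) (i : Fin n) (v : Fin m) :
    answer (Function.update w i v) + Pi.single (w i) 1 = answer w + Pi.single v 1 := by
  funext j
  simp only [Pi.add_apply, answer_eq_sum]
  rw [← Finset.add_sum_erase _ _ (Finset.mem_univ i),
    ← Finset.add_sum_erase _ (fun x => if w x = j then 1 else 0) (Finset.mem_univ i)]
  have : ∑ x ∈ Finset.univ.erase i, (if Function.update w i v x = j then 1 else 0) =
      ∑ x ∈ Finset.univ.erase i, if w x = j then 1 else 0 :=
    Finset.sum_congr rfl fun x hx => by
      rw [Function.update_of_ne (Finset.ne_of_mem_erase hx)]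
  simp only [this, Function.update_self, Pi.single_apply, eq_comm (a := j)]
  ring

/-- Double counting: a weight on groups becomes a weight on tuples. With `sum_mul_mean` this allows
answers and means to be compared tuple by tuple. -/
theorem sum_mul_answer (g : Fin m → ℚ) (w : Fin n → Fin m) :
    ∑ j, g j * answer w j = ∑ i, g (w i) := by
  simp only [answer_eq_sum, Nat.cast_sum, Finset.mul_sum]
  rw [Finset.sum_comm]
  simp

theorem sum_mul_mean (g : Fin m → ℚ) :
    ∑ j, g j * T.mean j = ∑ i, ∑ j, g j * T.p i j := by
  simp only [mean_eq_column_sum, Finset.mul_sum]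
  exact Finset.sum_comm

theorem mean_nonneg (j : Fin m) : 0 ≤ T.mean j := by
  rw [mean_eq_column_sum]
  exact Finset.sum_nonneg fun i _ => T.nonneg i j

/-! ### Exchanges along alternating paths -/

/-- Some tuple of group `u` in `w` may also take group `v`. -/
def Step (w : Fin n → Fin m) (u v : Fin m) : Prop := ∃ i, w i = u ∧ T.p i v ≠ 0

/-- There is an alternating path with `l` steps from `u` to `v`. -/
def Path (w : Fin n → Fin m) : ℕ → Fin m → Fin m → Prop
  | 0, u, v => u = v
  | l + 1, u, v => ∃ x, T.Step w u x ∧ Path w l x v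

theorem exists_path {w : Fin n → Fin m} {u v : Fin m} (h : ReflTransGen (T.Step w) u v) :
    ∃ l, T.Path w l u v := by
  induction h using ReflTransGen.head_induction_on with
  | refl => exact ⟨0, rfl⟩
  | head h _ ih => obtain ⟨l, hl⟩ := ih; exact ⟨l + 1, _, h, hl⟩

/-- Only the first move of a shortest path is made; the rest of the path survives in the new world,
and the induction on length takes over. -/
theorem exists_exchange_of_path (l : ℕ) : ∀ (w : Fin n → Fin m) (j k : Fin m),
    T.Supported w → T.Path w l j k →
    ∃ w', T.Supported w' ∧ answer w' + Pi.single j 1 = answer w + Pi.single k 1 := by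
  classical
  induction l using Nat.strong_induction_on with
  | _ l ih =>
  intro w j k hw hp
  by_cases hmin : ∃ l' < l, T.Path w l' j k
  · obtain ⟨l', hl', hp'⟩ := hmin
    exact ih l' hl' w j k hw hp'
  push Not at hmin
  cases l with
  | zero => cases hp; exact ⟨w, hw, rfl⟩
  | succ l =>
    obtain ⟨x, ⟨i, rfl, hx⟩, hxk⟩ := hp
    -- The tail cannot use tuple `i` again: it would then pass through `w i`, which would give a
    -- shorter path from `w i` to `k`.
    have key : ∀ s u, s ≤ l → T.Path w s u k → T.Path (Function.update w i x) s u k := by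
      intro s
      induction s with
      | zero => exact fun u _ h => h
      | succ s ihs =>
        rintro u hs ⟨y, ⟨i', rfl, hy⟩, hyk⟩
        refine ⟨y, ⟨i', ?_, hy⟩, ihs y (by omega) hyk⟩
        rw [Function.update_of_ne]
        rintro rfl
        exact hmin (s + 1) (by omega) ⟨y, ⟨i', rfl, hy⟩, hyk⟩
    have hsup : T.Supported (Function.update w i x) := by
      intro i'
      by_cases h : i' = i
      · subst h; simpa using hx
      · simpa [Function.update_of_ne h] using hw i'
    obtain ⟨w', hw', he⟩ := ih l (by omega) _ x k hsup (key l x le_rfl hxk)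
    refine ⟨w', hw', ?_⟩
    have h1 := answer_update w i x
    have h2 : answer w' + Pi.single (w i) 1 + (Pi.single x 1 : Fin m → ℕ) =
        answer w + Pi.single k 1 + (Pi.single x 1 : Fin m → ℕ) := by
      calc _ = (answer w' + Pi.single x 1) + Pi.single (w i) 1 := by abel
        _ = (answer (Function.update w i x) + Pi.single (w i) 1) + Pi.single k 1 := by
          rw [he]; abel
        _ = _ := by rw [h1]; abel
    exact add_right_cancel h2

/-- No tuple can be moved along an alternating path so that the answer comes closer to the mean. -/
def LocallyOptimal (w : Fin n → Fin m) : Prop :=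
  ∀ j k, ReflTransGen (T.Step w) j k → answer w j - T.mean j ≤ answer w k + 1 - T.mean k

end ProbTable

/-- The change of a separable function when one unit is moved from `j` to `k`. -/
theorem sum_exchange {ι M : Type*} [DecidableEq ι] [AddCommMonoid M] (s : Finset ι)
    (g : ι → ℕ → M) {r r' : ι → ℕ} {j k : ι} (hj : j ∈ s) (hk : k ∈ s) (hjk : j ≠ k)
    (h : ∀ v ∈ s, v ≠ j → v ≠ k → r' v = r v) :
    ∑ v ∈ s, g v (r' v) + (g j (r j) + g k (r k)) =
      ∑ v ∈ s, g v (r v) + (g j (r' j) + g k (r' k)) := by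
  have hk' : k ∈ s.erase j := Finset.mem_erase.2 ⟨hjk.symm, hk⟩
  rw [← Finset.add_sum_erase s _ hj, ← Finset.add_sum_erase s (fun v => g v (r v)) hj,
    ← Finset.add_sum_erase _ _ hk', ← Finset.add_sum_erase _ (fun v => g v (r v)) hk']
  have : ∑ v ∈ (s.erase j).erase k, g v (r' v) = ∑ v ∈ (s.erase j).erase k, g v (r v) :=
    Finset.sum_congr rfl fun v hv => by
      simp only [Finset.mem_erase] at hv
      rw [h v hv.2.2 hv.2.1 hv.1]
  rw [this]
  ac_rfl

/-! ### Local optimality, global optimality and rounding -/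

namespace ProbTable

open Relation

variable {n m : ℕ} (T : ProbTable n m)

theorem IsClosestPossible.locallyOptimal {T : ProbTable n m} {w : Fin n → Fin m}
    (hw : T.Supported w) (h : T.IsClosestPossible (answer w)) : T.LocallyOptimal w := by
  intro j k hjk
  rcases eq_or_ne j k with rfl | hne
  · linarith
  obtain ⟨l, hl⟩ := T.exists_path hjk
  obtain ⟨w', hw', he⟩ := T.exists_exchange_of_path l w j k hw hl
  have hle := h.2 _ ((T.isPossible_iff _).2 ⟨w', hw', rfl⟩)
  have hs := sum_exchange Finset.univ (fun v x => ((x : ℚ) - T.mean v) ^ 2)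
    (r := answer w) (r' := answer w') (Finset.mem_univ j) (Finset.mem_univ k) hne
    (fun v _ hvj hvk => by simpa [Pi.single_apply, hvj, hvk] using congrFun he v)
  have hj : (answer w' j : ℚ) + 1 = answer w j := by
    have := congrFun he j
    simp [hne] at this
    exact_mod_cast this
  have hk : (answer w' k : ℚ) = answer w k + 1 := by
    have := congrFun he k
    simp [hne.symm] at this
    exact_mod_cast this
  unfold sqDistMean at hle
  rw [hk, ← hj] at hs
  rw [← hj]
  nlinarith

/-- Duality: a potential built from reachability bounds the change of the objective from below by a
linear function of the answer, and that function does not decrease on passing to any other possible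
world. -/
theorem LocallyOptimal.isClosestPossible {T : ProbTable n m} {w : Fin n → Fin m}
    (hw : T.Supported w) (h : T.LocallyOptimal w) : T.IsClosestPossible (answer w) := by
  classical
  refine ⟨(T.isPossible_iff _).2 ⟨w, hw, rfl⟩, fun r' hr' => ?_⟩
  obtain ⟨w', hw', rfl⟩ := (T.isPossible_iff _).1 hr'
  have hne : ∀ v, (Finset.univ.filter fun j => ReflTransGen (T.Step w) j v).Nonempty :=
    fun v => ⟨v, by simpa using ReflTransGen.refl⟩
  let π : Fin m → ℚ := fun v =>
    (Finset.univ.filter fun j => ReflTransGen (T.Step w) j v).sup' (hne v)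
      fun j => answer w j - T.mean j
  have hlow : ∀ j v, ReflTransGen (T.Step w) j v → answer w j - T.mean j ≤ π v := fun j v hj =>
    Finset.le_sup' (fun j => (answer w j : ℚ) - T.mean j) (by simpa using hj)
  have hup : ∀ v, π v ≤ answer w v + 1 - T.mean v := fun v =>
    Finset.sup'_le _ _ fun j hj => h j v (by simpa using hj)
  -- Whatever reaches `w i` also reaches `w' i`, through the arc given by tuple `i` itself.
  have hmono : ∀ i, π (w i) ≤ π (w' i) := fun i =>
    Finset.sup'_le _ _ fun j hj =>
      hlow j _ ((Finset.mem_filter.1 hj).2.tail ⟨i, rfl, hw' i⟩)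
  have hsum : ∑ j, π j * answer w j ≤ ∑ j, π j * answer w' j := by
    rw [sum_mul_answer, sum_mul_answer]
    exact Finset.sum_le_sum fun i _ => hmono i
  have hone : ∑ j, (answer w j : ℚ) = ∑ j, (answer w' j : ℚ) := by
    have h1 := sum_mul_answer (fun _ => 1) w
    have h2 := sum_mul_answer (fun _ => 1) w'
    simp only [one_mul] at h1 h2
    rw [h1, h2]
  -- On integers the slopes next to `answer w v` are `2 * (answer w v - mean v) - 1` and `2 *
  -- (answer w v - mean v) + 1`; `hlow` and `hup` place `2 * π v - 1` between them.
  have hterm : ∀ v, (2 * π v - 1) * ((answer w' v : ℚ) - answer w v) ≤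
      ((answer w' v : ℚ) - T.mean v) ^ 2 - ((answer w v : ℚ) - T.mean v) ^ 2 := by
    intro v
    have h1 := hlow v v .refl
    have h2 := hup v
    rcases lt_trichotomy (answer w' v) (answer w v) with hlt | heq | hgt
    · have : (answer w' v : ℚ) + 1 ≤ answer w v := by exact_mod_cast hlt
      nlinarith
    · simp [heq]
    · have : (answer w v : ℚ) + 1 ≤ answer w' v := by exact_mod_cast hgt
      nlinarith
  have hfin := Finset.sum_le_sum fun v (_ : v ∈ Finset.univ) => hterm v
  have hexp : ∑ v, (2 * π v - 1) * ((answer w' v : ℚ) - answer w v) =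
      2 * (∑ j, π j * answer w' j - ∑ j, π j * answer w j) -
        (∑ j, (answer w' j : ℚ) - ∑ j, (answer w j : ℚ)) := by
    simp only [← Finset.sum_sub_distrib, Finset.mul_sum]
    exact Finset.sum_congr rfl fun v _ => by ring
  rw [hexp, Finset.sum_sub_distrib] at hfin
  unfold sqDistMean
  linarith

/-- The groups reachable from `j` are closed under arcs, so tuples in them have all their
probability there, and the total mean on this set is at least the total count. An excess of one at
`j` would force the opposite strict inequality. -/
theorem LocallyOptimal.answer_lt {T : ProbTable n m} {w : Fin n → Fin m}
    (h : T.LocallyOptimal w) (j : Fin m) : (answer w j : ℚ) < T.mean j + 1 := by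
  classical
  by_contra! hj
  let g : Fin m → ℚ := fun v => if ReflTransGen (T.Step w) j v then 1 else 0
  have hle : ∑ v, g v * answer w v ≤ ∑ v, g v * T.mean v := by
    rw [sum_mul_answer, sum_mul_mean]
    refine Finset.sum_le_sum fun i _ => ?_
    by_cases hi : ReflTransGen (T.Step w) j (w i)
    · have : ∀ v, g v * T.p i v = T.p i v := by
        intro v
        by_cases hv : T.p i v = 0
        · simp [hv]
        · simp [g, hi.tail ⟨i, rfl, hv⟩]
      simp [this, T.row_sum, g, hi]
    · simp only [g, hi, if_false]
      exact Finset.sum_nonneg fun v _ => mul_nonneg (by split_ifs <;> simp) (T.nonneg i v)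
  refine absurd hle (not_le.2 (Finset.sum_lt_sum (fun v _ => ?_) ⟨j, Finset.mem_univ j, ?_⟩))
  · by_cases hv : ReflTransGen (T.Step w) j v
    · have := h j v hv
      simp only [g, hv, if_true]
      linarith
    · simp [g, hv]
  · simp only [g, ReflTransGen.refl, if_true]
    linarith

/-- The mirror image of `answer_lt`, on the set of groups that reach `j`: tuples outside contribute
no probability to it and tuples inside contribute at most one. -/
theorem LocallyOptimal.lt_answer {T : ProbTable n m} {w : Fin n → Fin m}
    (h : T.LocallyOptimal w) (j : Fin m) : T.mean j - 1 < (answer w j : ℚ) := by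
  classical
  by_contra! hj
  let g : Fin m → ℚ := fun v => if ReflTransGen (T.Step w) v j then 1 else 0
  have hle : ∑ v, g v * T.mean v ≤ ∑ v, g v * answer w v := by
    rw [sum_mul_answer, sum_mul_mean]
    refine Finset.sum_le_sum fun i _ => ?_
    by_cases hi : ReflTransGen (T.Step w) (w i) j
    · simp only [g, hi, if_true]
      refine (Finset.sum_le_sum fun v _ => ?_).trans (T.row_sum i).le
      have := T.nonneg i v
      split_ifs <;> simp [this]
    · have : ∀ v, g v * T.p i v = 0 := by
        intro v
        by_cases hv : T.p i v = 0
        · simp [hv]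
        · simp only [g, mul_eq_zero, hv, or_false, ite_eq_right_iff, one_ne_zero, imp_false]
          exact fun hvj => hi (hvj.head ⟨i, rfl, hv⟩)
      simp [this, g, hi]
  refine absurd hle (not_le.2 (Finset.sum_lt_sum (fun v _ => ?_) ⟨j, Finset.mem_univ j, ?_⟩))
  · by_cases hv : ReflTransGen (T.Step w) v j
    · have := h v j hv
      simp only [g, hv, if_true]
      linarith
    · simp [g, hv]
  · simp only [g, ReflTransGen.refl, if_true]
    linarith

theorem IsClosestPossible.eq_floor_or_ceil {T : ProbTable n m} {r : Fin m → ℕ}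
    (h : T.IsClosestPossible r) (j : Fin m) : r j = ⌊T.mean j⌋₊ ∨ r j = ⌈T.mean j⌉₊ := by
  obtain ⟨w, hw, rfl⟩ := (T.isPossible_iff _).1 h.1
  have hl := h.locallyOptimal hw
  have h1 := hl.answer_lt j
  have h2 := hl.lt_answer j
  rcases le_total (answer w j : ℚ) (T.mean j) with h3 | h3
  · left
    exact ((Nat.floor_eq_iff (T.mean_nonneg j)).2 ⟨h3, by linarith⟩).symm
  · right
    -- `Nat.ceil_eq_iff` needs a nonzero value; a zero count not below the mean makes the mean zero.
    rcases eq_or_ne (answer w j) 0 with h0 | h0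
    · have : T.mean j = 0 := le_antisymm (by simpa [h0] using h3) (T.mean_nonneg j)
      simp [h0, this]
    · refine ((Nat.ceil_eq_iff h0).2 ⟨?_, h3⟩).symm
      rw [Nat.cast_sub (Nat.one_le_iff_ne_zero.2 h0)]
      push_cast
      linarith

theorem ceil_eq_floor_add_one {j : Fin m} (h : (⌊T.mean j⌋₊ : ℚ) ≠ T.mean j) :
    ⌈T.mean j⌉₊ = ⌊T.mean j⌋₊ + 1 := by
  refine le_antisymm (Nat.ceil_le_floor_add_one _) (Nat.succ_le_of_lt ?_)
  rw [Nat.lt_ceil]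
  exact lt_of_le_of_ne (Nat.floor_le (T.mean_nonneg j)) h

theorem ceil_eq_floor {j : Fin m} (h : (⌊T.mean j⌋₊ : ℚ) = T.mean j) :
    ⌈T.mean j⌉₊ = ⌊T.mean j⌋₊ := by
  conv_lhs => rw [← h]
  simp

/-! ### Flows in the network -/

/-- The flow through the extra edge at group `j`, and `0` if there is no such edge. -/
def extraFlow (f : T.Edge → ℕ) (j : Fin m) : ℕ :=
  if h : (⌊T.mean j⌋₊ : ℚ) ≠ T.mean j then f (.inr (.inr (.inr ⟨j, h⟩))) else 0

theorem sum_extra {M : Type*} [AddCommMonoid M]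
    (g : {j : Fin m // (⌊T.mean j⌋₊ : ℚ) ≠ T.mean j} → M) :
    ∑ e, g e = ∑ j, if h : (⌊T.mean j⌋₊ : ℚ) ≠ T.mean j then g ⟨j, h⟩ else 0 := by
  rw [Finset.sum_dite]
  simp only [Finset.sum_const_zero, add_zero]
  symm
  apply Finset.sum_bij (fun x _ => (⟨x.1, (Finset.mem_filter.1 x.2).2⟩ : {j : Fin m // _}))
  · simp
  · intro a _ b _ hab
    exact Subtype.ext (by simpa using hab)
  · intro b _
    exact ⟨⟨b.1, by simpa using b.2⟩, by simp, rfl⟩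
  · simp

theorem sum_extra_eq (f : T.Edge → ℕ) (j : Fin m) :
    (∑ e : {j : Fin m // (⌊T.mean j⌋₊ : ℚ) ≠ T.mean j},
      if e.1 = j then f (.inr (.inr (.inr e))) else 0) = T.extraFlow f j := by
  rw [sum_extra, Finset.sum_eq_single j]
  · simp [extraFlow]
  · intro b _ hb
    simp [hb]
  · simp

/-- Value `n` through `n` source edges of capacity one saturates each of them, so every tuple passes
on exactly one unit. -/
theorem isFlow_iff (f : T.Edge → ℕ) : T.network.IsFlow n f ↔
    (∀ i, f (.inl i) = 1) ∧ (∀ x, f (.inr (.inl x)) ≤ 1) ∧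
    (∀ j, f (.inr (.inr (.inl j))) = ⌊T.mean j⌋₊) ∧ (∀ e, f (.inr (.inr (.inr e))) ≤ 1) ∧
    (∀ i, (∑ x : {x : Fin n × Fin m // T.p x.1 x.2 ≠ 0},
      if x.1.1 = i then f (.inr (.inl x)) else 0) = 1) ∧
    (∀ j, (∑ x : {x : Fin n × Fin m // T.p x.1 x.2 ≠ 0},
      if x.1.2 = j then f (.inr (.inl x)) else 0) = ⌊T.mean j⌋₊ + T.extraFlow f j) := by
  have hsum : ∀ g : Fin n → ℕ, (∀ i, g i ≤ 1) → ∑ i, g i = n → ∀ i, g i = 1 := by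
    intro g hg hs i
    have h1 : ∑ i, g i = ∑ i : Fin n, 1 := by simpa using hs
    exact (Finset.sum_eq_sum_iff_of_le fun i _ => hg i).1 h1 i (Finset.mem_univ i)
  unfold FlowNetwork.IsFlow
  simp only [Finset.sum_filter, Fintype.sum_sum_type]
  constructor
  · rintro ⟨hb, hc, hs⟩
    have hi : ∀ i, f (.inl i) = 1 := by
      apply hsum _ fun i => (hb (.inl i)).2
      simpa [network] using hs
    have hbase : ∀ j, f (.inr (.inr (.inl j))) = ⌊T.mean j⌋₊ := fun j =>
      le_antisymm (hb (.inr (.inr (.inl j)))).2 (hb (.inr (.inr (.inl j)))).1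
    refine ⟨hi, fun x => (hb (.inr (.inl x))).2, hbase,
      fun e => (hb (.inr (.inr (.inr e)))).2, fun i => ?_, fun j => ?_⟩
    · have := hc (.tuple i) (by simp [network]) (by simp [network])
      simp [network, hi] at this
      exact this.symm
    · have := hc (.group j) (by simp [network]) (by simp [network])
      simp [network, hbase, sum_extra_eq] at this
      exact this
  · rintro ⟨hi, hx, hbase, he, ht, hg⟩
    refine ⟨?_, ?_, ?_⟩
    · rintro (i | x | j | e)
      · simp [network, hi]
      · simpa [network] using hx x
      · simp [network, hbase]
      · simpa [network] using he e
    · rintro (_ | i | j | _) hv1 hv2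
      · simp [network] at hv1
      · simp [network, hi, ht]
      · simp [network, hbase, hg, sum_extra_eq]
      · simp [network] at hv2
    · simp [network, hi]

theorem readOff_eq {f : T.Edge → ℕ} (hf : ∀ e, f (.inr (.inr (.inr e))) ≤ 1) (j : Fin m) :
    T.readOff f j = ⌊T.mean j⌋₊ + T.extraFlow f j := by
  unfold readOff extraFlow
  by_cases h : (⌊T.mean j⌋₊ : ℚ) ≠ T.mean j
  · have h1 := hf ⟨j, h⟩
    simp only [h, dif_pos, exists_true_left, not_false_eq_true, ne_eq]
    split_ifs with h2
    · rw [T.ceil_eq_floor_add_one h, h2]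
    · omega
  · simp [h]

/-- The extra flow is zero or one, and the cost of an extra edge is the increase of the squared
deviation caused by rounding up instead of down. -/
theorem sqDistMean_readOff {f : T.Edge → ℕ} (hf : ∀ e, f (.inr (.inr (.inr e))) ≤ 1) :
    T.sqDistMean (T.readOff f) =
      ∑ j, ((⌊T.mean j⌋₊ : ℚ) - T.mean j) ^ 2 + T.network.flowCost f := by
  unfold sqDistMean FlowNetwork.flowCost
  simp only [Fintype.sum_sum_type]
  simp only [network, zero_mul, Finset.sum_const_zero, zero_add]
  rw [sum_extra, ← Finset.sum_add_distrib]
  refine Finset.sum_congr rfl fun j _ => ?_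
  rw [T.readOff_eq hf, extraFlow]
  split_ifs with h
  · rw [T.ceil_eq_floor_add_one h]
    have := hf ⟨j, h⟩
    interval_cases f (.inr (.inr (.inr ⟨j, h⟩))) <;> simp
  · simp

theorem sum_support {M : Type*} [AddCommMonoid M] {w : Fin n → Fin m} (hw : T.Supported w)
    (g : Fin n → M) : (∑ x : {x : Fin n × Fin m // T.p x.1 x.2 ≠ 0},
      if w x.1.1 = x.1.2 then g x.1.1 else 0) = ∑ i, g i := by
  rw [← Finset.sum_filter]
  symm
  apply Finset.sum_bij
    (fun i _ => (⟨(i, w i), hw i⟩ : {x : Fin n × Fin m // T.p x.1 x.2 ≠ 0}))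
  · simp
  · intro a _ b _ hab
    simp only [Subtype.mk.injEq, Prod.mk.injEq] at hab
    exact hab.1
  · rintro ⟨⟨i, j⟩, hx⟩ hb
    simp only [Finset.mem_filter, Finset.mem_univ, true_and] at hb
    exact ⟨i, Finset.mem_univ i, by simp [hb]⟩
  · simp

theorem sum_support_group {w : Fin n → Fin m} (hw : T.Supported w) (j : Fin m) :
    (∑ x : {x : Fin n × Fin m // T.p x.1 x.2 ≠ 0},
      if x.1.2 = j then (if w x.1.1 = x.1.2 then 1 else 0) else 0) = answer w j := by
  rw [answer_eq_sum, ← T.sum_support hw]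
  refine Finset.sum_congr rfl fun x _ => ?_
  by_cases h : w x.1.1 = x.1.2
  · simp [h]
  · simp [h]

/-- By integrality the unit leaving a tuple uses a single edge. These edges form a world, and
conservation at the groups identifies its answer. -/
theorem isPossible_readOff {f : T.Edge → ℕ} (hf : T.network.IsFlow n f) :
    T.IsPossible (T.readOff f) := by
  obtain ⟨-, hx, -, he, ht, hg⟩ := (T.isFlow_iff f).1 hf
  have hex : ∀ i, ∃ x : {x : Fin n × Fin m // T.p x.1 x.2 ≠ 0},
      x.1.1 = i ∧ f (.inr (.inl x)) = 1 ∧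
        ∀ y : {x : Fin n × Fin m // T.p x.1 x.2 ≠ 0}, y ≠ x → y.1.1 = i →
          f (.inr (.inl y)) = 0 := by
    intro i
    have h := ht i
    obtain ⟨x, -, hxi⟩ := Finset.exists_ne_zero_of_sum_ne_zero (h.trans_ne one_ne_zero)
    have hxi' : x.1.1 = i ∧ f (.inr (.inl x)) ≠ 0 := by simpa using hxi
    have hx1 : f (.inr (.inl x)) = 1 := by have := hx x; omega
    refine ⟨x, hxi'.1, hx1, fun y hy hyi => ?_⟩
    rw [← Finset.add_sum_erase _ _ (Finset.mem_univ x), if_pos hxi'.1, hx1] at h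
    have h0 := Finset.sum_eq_zero_iff.1 (Nat.add_eq_left.1 h) y (by simp [hy])
    simpa [hyi] using h0
  choose X hXi hX1 hX0 using hex
  have hw : T.Supported fun i => (X i).1.2 := fun i => by
    have := (X i).2
    rwa [hXi i] at this
  refine (T.isPossible_iff _).2 ⟨_, hw, funext fun j => ?_⟩
  rw [T.readOff_eq he, ← hg, ← T.sum_support_group hw]
  refine Finset.sum_congr rfl fun x _ => ?_
  congr 1
  by_cases h : x = X x.1.1
  · rw [if_pos (by rw [← h]), h, hX1]
  · rw [hX0 _ x h rfl, if_neg]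
    intro h'
    exact h (Subtype.ext (Prod.ext (hXi _).symm h'.symm))

theorem IsClosestPossible.exists_flow {T : ProbTable n m} {r : Fin m → ℕ}
    (h : T.IsClosestPossible r) : ∃ f, T.network.IsFlow n f ∧ r = T.readOff f := by
  obtain ⟨w, hw, rfl⟩ := (T.isPossible_iff _).1 h.1
  let f : T.Edge → ℕ
    | .inl _ => 1
    | .inr (.inl x) => if w x.1.1 = x.1.2 then 1 else 0
    | .inr (.inr (.inl j)) => ⌊T.mean j⌋₊
    -- By `eq_floor_or_ceil` the truncated subtraction is exact and the value respects capacity one.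
    | .inr (.inr (.inr e)) => answer w e.1 - ⌊T.mean e.1⌋₊
  have he : ∀ e, f (.inr (.inr (.inr e))) ≤ 1 := by
    intro e
    have h1 := T.ceil_eq_floor_add_one e.2
    have h2 := h.eq_floor_or_ceil e.1
    simp only [f]
    omega
  have hans : ∀ j, answer w j = ⌊T.mean j⌋₊ + T.extraFlow f j := by
    intro j
    have h2 := h.eq_floor_or_ceil j
    unfold extraFlow
    split_ifs with hj
    · have h1 := T.ceil_eq_floor_add_one hj
      simp only [f]
      omega
    · have h1 := T.ceil_eq_floor (not_not.1 hj)
      omega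
  refine ⟨f, (T.isFlow_iff f).2 ⟨fun _ => rfl, fun x => ?_, fun _ => rfl, he, fun i => ?_,
    fun j => ?_⟩, funext fun j => ?_⟩
  · simp only [f]
    split_ifs <;> simp
  · have := T.sum_support hw fun i' => if i' = i then 1 else 0
    simp only [Finset.sum_ite_eq', Finset.mem_univ, if_true] at this
    rw [← this]
    refine Finset.sum_congr rfl fun x _ => ?_
    simp only [f]
    split_ifs <;> rfl
  · rw [← hans, ← T.sum_support_group hw]
  · rw [T.readOff_eq he, hans]

theorem isClosestPossible_iff_exists_isMinCostFlow (r : Fin m → ℕ) :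
    T.IsClosestPossible r ↔ ∃ f, T.network.IsMinCostFlow n f ∧ r = T.readOff f := by
  have hcost : ∀ f g, T.network.IsFlow n f → T.network.IsFlow n g →
      (T.sqDistMean (T.readOff f) ≤ T.sqDistMean (T.readOff g) ↔
        T.network.flowCost f ≤ T.network.flowCost g) := by
    intro f g hf hg
    rw [T.sqDistMean_readOff ((T.isFlow_iff f).1 hf).2.2.2.1,
      T.sqDistMean_readOff ((T.isFlow_iff g).1 hg).2.2.2.1]
    simp
  constructor
  · intro h
    obtain ⟨f, hf, rfl⟩ := h.exists_flow
    exact ⟨f, ⟨hf, fun g hg => (hcost f g hf hg).1 (h.2 _ (T.isPossible_readOff hg))⟩, rfl⟩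
  · rintro ⟨f, ⟨hf, hmin⟩, rfl⟩
    obtain ⟨r₀, h₀⟩ := T.exists_isClosestPossible
    obtain ⟨g, hg, rfl⟩ := h₀.exists_flow
    exact ⟨T.isPossible_readOff hf,
      fun r' hr' => ((hcost f g hf hg).2 (hmin g hg)).trans (h₀.2 r' hr')⟩

end ProbTable

/-! ### Binary length of sums and products -/

theorem Nat.size_mul_le (a b : ℕ) : (a * b).size ≤ a.size + b.size := by
  rw [Nat.size_le, pow_add]
  exact Nat.mul_lt_mul'' (Nat.lt_size_self a) (Nat.lt_size_self b)

theorem Nat.size_add_le {a b s : ℕ} (ha : a.size ≤ s) (hb : b.size ≤ s) :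
    (a + b).size ≤ s + 1 := by
  rw [Nat.size_le] at *
  rw [pow_succ]
  omega

theorem Nat.size_add_one_le (a : ℕ) : (a + 1).size ≤ a.size + 1 := by
  have := Nat.lt_size_self a
  rw [Nat.size_le, pow_succ]
  omega

namespace RAM

theorem State.set_apply_self (σ : State) (a i v : ℕ) :
    σ.set a i v a = Function.update (σ a) i v := by
  simp [State.set]

theorem State.set_apply_of_ne (σ : State) {a b : ℕ} (i v : ℕ) (h : b ≠ a) :
    σ.set a i v b = σ b := by
  simp [State.set, h]

/-! ### Programs with bounded loops -/

/-- Programs whose loops are all bounded: `count v x c` runs `c` for the values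
`0, …, k - 1` of the scalar `v`, where `k` is the content of register `x` of array `0`. -/
inductive Loop where
  | skip
  | store (a : ℕ) (i e : Expr)
  | seq (c d : Loop)
  | ite (b : Expr) (c d : Loop)
  | count (v x : ℕ) (c : Loop)

namespace Loop

/-- The memory after the execution of a program. -/
def run : Loop → State → State
  | skip, σ => σ
  | store a i e, σ => σ.set a (i.eval σ) (e.eval σ)
  | seq c d, σ => d.run (c.run σ)
  | ite b c d, σ => if b.eval σ ≠ 0 then c.run σ else d.run σ
  | count v x c, σ =>
      (fun τ => (c.run τ).set v 0 (c.run τ v 0 + 1))^[σ 0 x] (σ.set v 0 0)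

/-- The test that the counter `v` is below register `x` of array `0`. -/
def test (v x : ℕ) : Expr := .sub (.get 0 (.const x)) (.get v (.const 0))

/-- The successor of the counter `v`. -/
def next (v : ℕ) : Expr := .add (.get v (.const 0)) (.const 1)

/-- The translation to the random access machine. -/
def compile : Loop → Cmd
  | skip => .skip
  | store a i e => .store a i e
  | seq c d => .seq c.compile d.compile
  | ite b c d => .ite b c.compile d.compile
  | count v x c => .seq (.store v (.const 0) (.const 0))
      (.loop (test v x) (.seq c.compile (.store v (.const 0) (next v))))

/-- The arrays that a program writes to. -/
def writes : Loop → List ℕ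
  | skip => []
  | store a _ _ => [a]
  | seq c d => c.writes ++ d.writes
  | ite _ c d => c.writes ++ d.writes
  | count v _ c => v :: c.writes

/-- The frame rule. For a concrete program its side condition is settled by `decide`. -/
theorem run_of_notMem_writes (c : Loop) :
    ∀ (σ : State) {a : ℕ}, a ∉ c.writes → c.run σ a = σ a := by
  induction c with
  | skip => intro σ a _; rfl
  | store b i e =>
    intro σ a h
    exact State.set_apply_of_ne _ _ _ (by simpa [writes] using h)
  | seq c d ihc ihd =>
    intro σ a h
    simp only [writes, List.mem_append, not_or] at h
    simp only [run]
    rw [ihd _ h.2, ihc _ h.1]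
  | ite b c d ihc ihd =>
    intro σ a h
    simp only [writes, List.mem_append, not_or] at h
    simp only [run]
    split_ifs
    · exact ihc _ h.1
    · exact ihd _ h.2
  | count v x c ih =>
    intro σ a h
    simp only [writes, List.mem_cons, not_or] at h
    simp only [run]
    have : ∀ k (τ : State),
        ((fun τ => (c.run τ).set v 0 (c.run τ v 0 + 1))^[k] τ) a = τ a := by
      intro k
      induction k with
      | zero => intro τ; rfl
      | succ k ihk =>
        intro τ
        rw [Function.iterate_succ_apply, ihk, State.set_apply_of_ne _ _ _ h.1, ih _ h.2]
    rw [this, State.set_apply_of_ne _ _ _ h.1]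

/-- The invariant rule for bounded loops. -/
theorem run_count {v x : ℕ} {c : Loop} {σ : State} (I : ℕ → State → Prop)
    (hv : v ∉ c.writes) (hI : ∀ k τ y, I k τ → I k (τ.set v 0 y)) (h0 : I 0 σ)
    (hs : ∀ k < σ 0 x, ∀ τ : State, (∀ a, a ≠ v → a ∉ c.writes → τ a = σ a) → τ v 0 = k →
      I k τ → I (k + 1) (c.run τ)) :
    I (σ 0 x) ((count v x c).run σ) := by
  have : ∀ k ≤ σ 0 x,
      let τ := (fun τ => (c.run τ).set v 0 (c.run τ v 0 + 1))^[k] (σ.set v 0 0)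
      (∀ a, a ≠ v → a ∉ c.writes → τ a = σ a) ∧ τ v 0 = k ∧ I k τ := by
    intro k
    induction k with
    | zero =>
      intro _
      exact ⟨fun a ha _ => State.set_apply_of_ne _ _ _ ha, by simp [State.set_apply_self],
        hI _ _ _ h0⟩
    | succ k ih =>
      intro hk
      obtain ⟨h1, h2, h3⟩ := ih (by omega)
      simp only [Function.iterate_succ_apply']
      refine ⟨fun a ha ha' => ?_, ?_, hI _ _ _ (hs k (by omega) _ h1 h2 h3)⟩
      · rw [State.set_apply_of_ne _ _ _ ha, run_of_notMem_writes _ _ ha', h1 a ha ha']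
      · rw [State.set_apply_self, Function.update_self, run_of_notMem_writes _ _ hv, h2]
  exact (this _ le_rfl).2.2

end Loop

/-! ### The cost of programs with bounded loops -/

namespace Expr

/-- The degree of an expression in the contents of the arrays other than `0`, `1` and `2`. -/
def degree : Expr → ℕ
  | const _ => 0
  | get a _ => if a < 3 then 0 else 1
  | add x y => max x.degree y.degree
  | sub x _ => x.degree
  | mul x y => x.degree + y.degree
  | div x _ => x.degree

/-- With `degree`, this bounds the binary length of the value of an expression. -/
def weight : Expr → ℕ
  | const k => k.size
  | get _ _ => 1
  | add x y => x.weight + y.weight + 1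
  | sub x _ => x.weight
  | mul x y => x.weight + y.weight
  | div x _ => x.weight

/-- The binary length of the value is at most this multiple of the binary length of the memory. -/
def span (e : Expr) : ℕ := e.degree + e.weight

/-- The cost is at most this multiple of the square of the binary length of the memory. -/
def costCoeff : Expr → ℕ
  | const k => k.size + 1
  | get _ i => i.costCoeff + i.span + 1 + 1
  | add x y => x.costCoeff + y.costCoeff + x.span + y.span + 1
  | sub x y => x.costCoeff + y.costCoeff + x.span + y.span + 1
  | mul x y => x.costCoeff + y.costCoeff + (x.span + 1) * (y.span + 1)
  | div x y => x.costCoeff + y.costCoeff + (x.span + 1) * (y.span + 1)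

end Expr

/-- The contents of the arrays `0`, `1` and `2` have binary length at most `B₀`, and the contents
of all other arrays have binary length at most `B`. -/
def State.Bounded (σ : State) (B₀ B : ℕ) : Prop :=
  (∀ a < 3, ∀ i, (σ a i).size ≤ B₀) ∧ ∀ a, 3 ≤ a → ∀ i, (σ a i).size ≤ B

theorem State.Bounded.mono {σ : State} {B₀ B B' : ℕ} (h : σ.Bounded B₀ B) (hB : B ≤ B') :
    σ.Bounded B₀ B' :=
  ⟨h.1, fun a ha i => (h.2 a ha i).trans hB⟩

theorem State.Bounded.set {σ : State} {B₀ B : ℕ} (h : σ.Bounded B₀ B) {a i v : ℕ} (ha : 3 ≤ a)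
    (hv : v.size ≤ B) : (σ.set a i v).Bounded B₀ B := by
  refine ⟨fun b hb x => ?_, fun b hb x => ?_⟩
  · rw [State.set_apply_of_ne _ _ _ (by omega)]
    exact h.1 b hb x
  · by_cases hba : b = a
    · subst hba
      rw [State.set_apply_self, Function.update_apply]
      split_ifs
      · exact hv
      · exact h.2 b hb x
    · rw [State.set_apply_of_ne _ _ _ hba]
      exact h.2 b hb x

/-- Lengths add under multiplication, so a product of working values adds up multiples of `B`, while
sums add only to the `B₀` part. The address of a memory access plays no role, since all registers of
an array share one bound. -/
theorem Expr.size_eval_le {σ : State} {B₀ B : ℕ} (h : σ.Bounded B₀ B) (e : Expr) :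
    (e.eval σ).size ≤ e.degree * B + e.weight * (B₀ + 1) := by
  induction e with
  | const k =>
    simp only [eval, degree, weight]
    nlinarith
  | get a i =>
    simp only [eval, degree, weight]
    split_ifs with ha
    · have := h.1 a ha (i.eval σ)
      omega
    · have := h.2 a (by omega) (i.eval σ)
      omega
  | add x y ihx ihy =>
    simp only [eval, degree, weight]
    have h1 := Nat.mul_le_mul_right B (le_max_left x.degree y.degree)
    have h2 := Nat.mul_le_mul_right B (le_max_right x.degree y.degree)
    have h3 := Nat.zero_le (x.weight * (B₀ + 1))
    have h4 := Nat.zero_le (y.weight * (B₀ + 1))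
    refine (Nat.size_add_le (s := max x.degree y.degree * B + x.weight * (B₀ + 1) +
      y.weight * (B₀ + 1)) (by omega) (by omega)).trans ?_
    nlinarith
  | sub x y ihx ihy => exact (Nat.size_le_size (Nat.sub_le _ _)).trans ihx
  | mul x y ihx ihy =>
    simp only [eval, degree, weight]
    refine (Nat.size_mul_le _ _).trans ?_
    nlinarith
  | div x y ihx ihy => exact (Nat.size_le_size (Nat.div_le_self _ _)).trans ihx

theorem Expr.size_eval_le_span {σ : State} {B₀ B X : ℕ} (h : σ.Bounded B₀ B)
    (hX : B + B₀ + 1 ≤ X) (e : Expr) : (e.eval σ).size ≤ e.span * X := by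
  refine (e.size_eval_le h).trans ?_
  rw [span, add_mul]
  exact add_le_add (Nat.mul_le_mul_left _ (by omega)) (Nat.mul_le_mul_left _ (by omega))

theorem Expr.cost_le {σ : State} {B₀ B X : ℕ} (h : σ.Bounded B₀ B)
    (hX : B + B₀ + 1 ≤ X) (e : Expr) : e.cost σ ≤ e.costCoeff * X ^ 2 := by
  have hs := fun e => Expr.size_eval_le_span h hX e
  have h1 : 1 ≤ X := by omega
  have h2 : X ≤ X ^ 2 := by nlinarith
  have hs2 : ∀ e : Expr, (e.eval σ).size ≤ e.span * X ^ 2 := fun e =>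
    (hs e).trans (Nat.mul_le_mul_left _ h2)
  have hm : ∀ x y : Expr, ((x.eval σ).size + 1) * ((y.eval σ).size + 1) ≤
      (x.span + 1) * (y.span + 1) * X ^ 2 := by
    intro x y
    calc _ ≤ ((x.span + 1) * X) * ((y.span + 1) * X) :=
          Nat.mul_le_mul (by nlinarith [hs x]) (by nlinarith [hs y])
      _ = _ := by ring
  induction e with
  | const k =>
    simp only [cost, costCoeff]
    nlinarith
  | get a i ih =>
    simp only [cost, costCoeff, add_mul, one_mul]
    have : (σ a (i.eval σ)).size ≤ X := by
      rcases lt_or_ge a 3 with ha | ha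
      · exact (h.1 a ha _).trans (by omega)
      · exact (h.2 a ha _).trans (by omega)
    have := hs2 i
    omega
  | add x y ihx ihy =>
    simp only [cost, costCoeff, add_mul, one_mul]
    have := hs2 x
    have := hs2 y
    omega
  | sub x y ihx ihy =>
    simp only [cost, costCoeff, add_mul, one_mul]
    have := hs2 x
    have := hs2 y
    omega
  | mul x y ihx ihy =>
    refine (add_le_add (add_le_add ihx ihy) (hm x y)).trans_eq ?_
    simp only [costCoeff]
    ring
  | div x y ihx ihy =>
    refine (add_le_add (add_le_add ihx ihy) (hm x y)).trans_eq ?_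
    simp only [costCoeff]
    ring

namespace Loop

/-- Only arrays other than `0`, `1`, `2` are written to, values are stored that are at most linear
in their contents, loops run up to register `0` or `1` of array `0`, and counters are not modified
inside their loops. -/
def wellFormed : Loop → Bool
  | skip => true
  | store a _ e => decide (3 ≤ a) && decide (e.degree ≤ 1)
  | seq c d => c.wellFormed && d.wellFormed
  | ite _ c d => c.wellFormed && d.wellFormed
  | count v x c => decide (3 ≤ v) && decide (x ≤ 1) && decide (v ∉ c.writes) && c.wellFormed

theorem three_le_of_mem_writes {c : Loop} (hc : c.wellFormed) : ∀ {a : ℕ}, a ∈ c.writes → 3 ≤ a := by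
  induction c with
  | skip => intro a h; simp [writes] at h
  | store b i e =>
    intro a h
    simp only [wellFormed, Bool.and_eq_true, decide_eq_true_eq] at hc
    simp only [writes, List.mem_singleton] at h
    exact h ▸ hc.1
  | seq c d ihc ihd =>
    intro a h
    simp only [wellFormed, Bool.and_eq_true] at hc
    simp only [writes, List.mem_append] at h
    exact h.elim (ihc hc.1) (ihd hc.2)
  | ite b c d ihc ihd =>
    intro a h
    simp only [wellFormed, Bool.and_eq_true] at hc
    simp only [writes, List.mem_append] at h
    exact h.elim (ihc hc.1) (ihd hc.2)
  | count v x c ih =>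
    intro a h
    simp only [wellFormed, Bool.and_eq_true, decide_eq_true_eq] at hc
    simp only [writes, List.mem_cons] at h
    exact h.elim (fun h => h ▸ hc.1.1.1) (ih hc.2)

theorem run_apply_zero {c : Loop} (hc : c.wellFormed) (σ : State) : c.run σ 0 = σ 0 :=
  run_of_notMem_writes _ _ fun h => absurd (three_le_of_mem_writes hc h) (by omega)

/-- The factor by which a store costs more than the squared binary length of the memory. -/
def storeCoeff (i e : Expr) : ℕ := i.costCoeff + e.costCoeff + i.span + e.span + 1

/-- The factor by which a test costs more than the squared binary length of the memory. -/
def testCoeff (b : Expr) : ℕ := b.costCoeff + b.span + 1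

/-- A bound for the growth of the binary length of the memory, in terms of a bound for the
number of rounds of each loop. -/
noncomputable def growth : Loop → Polynomial ℕ
  | skip => 0
  | store _ _ e => (e.weight : Polynomial ℕ)
  | seq c d => c.growth + d.growth
  | ite _ c d => c.growth + d.growth
  | count _ _ c => Polynomial.X * (c.growth + 1)

/-- A bound for the number of steps, in terms of a bound for the number of rounds of each loop. -/
noncomputable def steps : Loop → Polynomial ℕ
  | skip => 1
  | store _ i e => (storeCoeff i e : Polynomial ℕ)
  | seq c d => c.steps + d.steps
  | ite b c d => (testCoeff b : Polynomial ℕ) + c.steps + d.steps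
  | count v x c => ((storeCoeff (.const 0) (.const 0) + testCoeff (test v x) : ℕ) : Polynomial ℕ) +
      Polynomial.X * (c.steps +
        ((storeCoeff (.const 0) (next v) + testCoeff (test v x) : ℕ) : Polynomial ℕ))

theorem store_cost_le {σ : State} {B₀ B X : ℕ} (h : σ.Bounded B₀ B) (hX : B + B₀ + 1 ≤ X)
    (i e : Expr) : i.cost σ + e.cost σ + (i.eval σ).size + (e.eval σ).size + 1 ≤
      storeCoeff i e * X ^ 2 := by
  have h1 := i.cost_le h hX
  have h2 := e.cost_le h hX
  have h3 := i.size_eval_le_span h hX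
  have h4 := e.size_eval_le_span h hX
  have h6 : X ≤ X ^ 2 := by nlinarith
  have h7 := Nat.mul_le_mul_left i.span h6
  have h8 := Nat.mul_le_mul_left e.span h6
  simp only [storeCoeff, add_mul, one_mul]
  omega

theorem test_cost_le {σ : State} {B₀ B X : ℕ} (h : σ.Bounded B₀ B) (hX : B + B₀ + 1 ≤ X)
    (b : Expr) : b.cost σ + (b.eval σ).size + 1 ≤ testCoeff b * X ^ 2 := by
  have h1 := b.cost_le h hX
  have h3 := b.size_eval_le_span h hX
  have h6 : X ≤ X ^ 2 := by nlinarith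
  have h7 := Nat.mul_le_mul_left b.span h6
  simp only [testCoeff, add_mul, one_mul]
  omega

/-- Induction on the remaining rounds `d`. Besides the growth `G * (B₀ + 1)` of the body, a round
may lengthen the counter by one bit, which `G + 1` absorbs. -/
theorem exec_loop {v x : ℕ} {c : Loop} {N B₀ G S : ℕ} (hv3 : 3 ≤ v) (hv : v ∉ c.writes)
    (hc0 : c.wellFormed)
    (ih : ∀ (B : ℕ) (σ : State), σ 0 0 ≤ N → σ 0 1 ≤ N → σ.Bounded B₀ B →
      (c.run σ).Bounded B₀ (B + G * (B₀ + 1)) ∧ ∃ t, Exec c.compile σ (c.run σ) t ∧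
        ∀ X, B + G * (B₀ + 1) + B₀ + 1 ≤ X → t ≤ S * X ^ 2) (d : ℕ) :
    ∀ (B : ℕ) (τ : State), τ 0 0 ≤ N → τ 0 1 ≤ N → τ v 0 + d = τ 0 x → τ.Bounded B₀ B →
      let υ := (fun τ => (c.run τ).set v 0 (c.run τ v 0 + 1))^[d] τ
      υ.Bounded B₀ (B + d * (G + 1) * (B₀ + 1)) ∧
        ∃ t, Exec (.loop (test v x) (.seq c.compile (.store v (.const 0) (next v)))) τ υ t ∧
          ∀ X, B + d * (G + 1) * (B₀ + 1) + B₀ + 1 ≤ X →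
            t ≤ (testCoeff (test v x) + d * (S + (storeCoeff (.const 0) (next v) +
              testCoeff (test v x)))) * X ^ 2 := by
  induction d with
  | zero =>
    intro B τ h0 h1 hd hB
    refine ⟨by simpa using hB, _, Exec.loop_false ?_, fun X hX => ?_⟩
    · simp only [test, Expr.eval]
      omega
    · rw [zero_mul, add_zero]
      exact test_cost_le hB (by simpa using hX) _
  | succ d ihd =>
    intro B τ h0 h1 hd hB
    obtain ⟨hB1, s, hs, hsX⟩ := ih B τ h0 h1 hB
    have hv1 : c.run τ v = τ v := run_of_notMem_writes _ _ hv
    have hz : c.run τ 0 = τ 0 := run_apply_zero hc0 τ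
    have hB2 : ((c.run τ).set v 0 (c.run τ v 0 + 1)).Bounded B₀ (B + (G + 1) * (B₀ + 1)) := by
      refine (hB1.mono (by nlinarith)).set hv3 ?_
      refine ((Nat.size_add_one_le _).trans (Nat.add_le_add_right (hB1.2 v hv3 0) 1)).trans ?_
      nlinarith
    obtain ⟨hB3, t, ht, htX⟩ := ihd _ _ (by rw [State.set_apply_of_ne _ _ _ (by omega), hz]; exact h0)
      (by rw [State.set_apply_of_ne _ _ _ (by omega), hz]; exact h1)
      (by rw [State.set_apply_of_ne _ _ _ (by omega : 0 ≠ v), hz, State.set_apply_self,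
        Function.update_self, hv1]; omega) hB2
    have he : B + (G + 1) * (B₀ + 1) + d * (G + 1) * (B₀ + 1) =
        B + (d + 1) * (G + 1) * (B₀ + 1) := by ring
    rw [he] at hB3 htX
    refine ⟨hB3, _, Exec.loop_true ?_ (Exec.seq hs (Exec.store _ v (.const 0) (next v))) ht,
      fun X hX => ?_⟩
    · simp only [test, Expr.eval]
      omega
    · have hG : G * (B₀ + 1) ≤ (d + 1) * (G + 1) * (B₀ + 1) :=
        Nat.mul_le_mul_right _ (by nlinarith)
      have c1 := test_cost_le hB (by omega) (test v x) (X := X)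
      have c2 := hsX X (by omega)
      have c3 := store_cost_le hB1 (by omega) (.const 0) (next v) (X := X)
      have c4 := htX X hX
      refine (add_le_add (add_le_add c1 (add_le_add c2 c3)) c4).trans_eq ?_
      ring

/-- A well-formed program with bounded loops runs in polynomial time. -/
theorem exec_compile (N B₀ : ℕ) {c : Loop} (hc : c.wellFormed) :
    ∀ (B : ℕ) (σ : State), σ 0 0 ≤ N → σ 0 1 ≤ N → σ.Bounded B₀ B →
      (c.run σ).Bounded B₀ (B + c.growth.eval N * (B₀ + 1)) ∧
        ∃ t, Exec c.compile σ (c.run σ) t ∧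
          ∀ X, B + c.growth.eval N * (B₀ + 1) + B₀ + 1 ≤ X → t ≤ c.steps.eval N * X ^ 2 := by
  induction c with
  | skip =>
    intro B σ _ _ hB
    refine ⟨by simpa [growth, run] using hB, 1, .skip σ, fun X hX => ?_⟩
    simp only [steps, Polynomial.eval_one, one_mul]
    exact Nat.one_le_pow _ _ (by omega)
  | store a i e =>
    intro B σ _ _ hB
    simp only [wellFormed, Bool.and_eq_true, decide_eq_true_eq] at hc
    simp only [growth, steps, Polynomial.eval_natCast, Nat.cast_id]
    refine ⟨(hB.mono (by omega)).set hc.1 ((e.size_eval_le hB).trans ?_), _, .store σ a i e,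
      fun X hX => store_cost_le hB (by omega) i e⟩
    -- Degree at most one keeps the coefficient of `B` at most one, so a store lengthens numbers
    -- additively; repeated squaring is excluded here.
    exact Nat.add_le_add_right (by nlinarith [hc.2]) _
  | seq c d ihc ihd =>
    intro B σ h0 h1 hB
    simp only [wellFormed, Bool.and_eq_true] at hc
    obtain ⟨hB1, s, hs, hsX⟩ := ihc hc.1 B σ h0 h1 hB
    have hz := run_apply_zero hc.1 σ
    obtain ⟨hB2, t, ht, htX⟩ := ihd hc.2 _ (c.run σ) (by rwa [hz]) (by rwa [hz]) hB1
    simp only [growth, steps, Polynomial.eval_add, add_mul, ← add_assoc]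
    refine ⟨hB2, _, .seq hs ht, fun X hX => add_le_add (hsX X (by omega)) (htX X hX)⟩
  | ite b c d ihc ihd =>
    intro B σ h0 h1 hB
    simp only [wellFormed, Bool.and_eq_true] at hc
    obtain ⟨hB1, s, hs, hsX⟩ := ihc hc.1 B σ h0 h1 hB
    obtain ⟨hB2, t, ht, htX⟩ := ihd hc.2 B σ h0 h1 hB
    simp only [growth, steps, Polynomial.eval_add, Polynomial.eval_natCast, Nat.cast_id, add_mul,
      ← add_assoc]
    by_cases hb : b.eval σ = 0
    · rw [show (ite b c d).run σ = d.run σ by simp [run, hb]]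
      refine ⟨hB2.mono (by omega), _, .ite_false hb ht, fun X hX => ?_⟩
      have := test_cost_le hB (by omega) b (X := X)
      have := htX X (by omega)
      omega
    · rw [show (ite b c d).run σ = c.run σ by simp [run, hb]]
      refine ⟨hB1.mono (by omega), _, .ite_true hb hs, fun X hX => ?_⟩
      have := test_cost_le hB (by omega) b (X := X)
      have := hsX X (by omega)
      omega
  | count v x c ih =>
    intro B σ h0 h1 hB
    simp only [wellFormed, Bool.and_eq_true, decide_eq_true_eq] at hc
    obtain ⟨⟨⟨hv3, hx⟩, hv⟩, hc⟩ := hc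
    have hxN : σ 0 x ≤ N := by interval_cases x <;> assumption
    have hz : σ.set v 0 0 0 = σ 0 := State.set_apply_of_ne _ _ _ (by omega)
    obtain ⟨hB1, t, ht, htX⟩ := exec_loop (x := x) hv3 hv hc (ih hc) (σ 0 x) B (σ.set v 0 0)
      (by rwa [hz]) (by rwa [hz])
      (by rw [hz, State.set_apply_self, Function.update_self, zero_add])
      (hB.set hv3 (by simp))
    simp only [growth, steps, Polynomial.eval_add, Polynomial.eval_mul, Polynomial.eval_X,
      Polynomial.eval_one, Polynomial.eval_natCast, Nat.cast_id]
    have hle : σ 0 x * (c.growth.eval N + 1) * (B₀ + 1) ≤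
        N * (c.growth.eval N + 1) * (B₀ + 1) :=
      Nat.mul_le_mul_right _ (Nat.mul_le_mul_right _ hxN)
    refine ⟨hB1.mono (by omega), _, .seq (.store σ v (.const 0) (.const 0)) ht,
      fun X hX => ?_⟩
    have c1 := store_cost_le hB (by omega) (.const 0) (.const 0) (X := X)
    have c2 := htX X (by omega)
    have c3 : σ 0 x * (c.steps.eval N + (storeCoeff (.const 0) (next v) +
        testCoeff (test v x))) * X ^ 2 ≤ N * (c.steps.eval N + (storeCoeff (.const 0) (next v) +
        testCoeff (test v x))) * X ^ 2 := Nat.mul_le_mul_right _ (Nat.mul_le_mul_right _ hxN)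
    rw [add_mul] at c2 ⊢
    rw [add_mul]
    refine (add_le_add c1 c2).trans ?_
    omega

/-- A bound for the cost of a program with bounded loops on inputs of size `N`. -/
noncomputable def costBound (c : Loop) : Polynomial ℕ :=
  c.steps * (c.growth * (Polynomial.X + 1) + Polynomial.X + 1) ^ 2

theorem exec_costBound {c : Loop} (hc : c.wellFormed) {N : ℕ} {σ : State} (h0 : σ 0 0 ≤ N)
    (h1 : σ 0 1 ≤ N) (hB : σ.Bounded N 0) :
    ∃ t, Exec c.compile σ (c.run σ) t ∧ t ≤ c.costBound.eval N := by
  obtain ⟨-, t, ht, htX⟩ := exec_compile N N hc 0 σ h0 h1 hB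
  refine ⟨t, ht, (htX _ le_rfl).trans_eq ?_⟩
  simp [costBound]

end Loop

end RAM

namespace Rounding

open RAM Relation

/-! ### The program -/

/-- The content of register `0` of array `a`. -/
def scalar (a : ℕ) : Expr := .get a (.const 0)

/-- The entry of the matrix `a` in the row and the column held by the scalars `i` and `j`. -/
def entry (a i j : ℕ) : Expr :=
  .get a (.add (.mul (scalar i) (.get 0 (.const 1))) (scalar j))

/-- Scalar `8` becomes a common denominator. -/
def initDenom : Loop :=
  .seq (.store 8 (.const 0) (.const 1))
    (.count 11 0 (.count 12 1 (.store 8 (.const 0) (.mul (scalar 8) (entry 2 11 12)))))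

/-- Array `9` becomes the vector of column sums, multiplied by the common denominator. -/
def initMean : Loop :=
  .count 12 1 (.count 11 0 (.store 9 (scalar 12) (.add (.get 9 (scalar 12))
    (.mul (entry 1 11 12) (.div (scalar 8) (entry 2 11 12))))))

/-- Array `4` becomes a world of nonzero probability. -/
def initWorld : Loop :=
  .count 11 0 (.count 12 1 (.ite (entry 1 11 12) (.store 4 (scalar 11) (scalar 12)) .skip))

/-- Array `3` becomes the answer in the world held by array `4`. -/
def initAnswer : Loop :=
  .count 11 0 (.store 3 (.get 4 (scalar 11)) (.add (.get 3 (.get 4 (scalar 11))) (.const 1)))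

/-- Tuple `11` may move from its group to the labelled group `12`, and its group has no label. -/
def relaxTest : Expr :=
  .mul (.mul (entry 1 11 12) (.get 5 (scalar 12)))
    (.mul (.sub (.add (scalar 13) (.const 2)) (.get 5 (scalar 12)))
      (.sub (.const 1) (.get 5 (.get 4 (scalar 11)))))

/-- Label the group of tuple `11`, with a pointer to group `12`. -/
def relax : Loop :=
  .ite relaxTest
    (.seq (.store 6 (.get 4 (scalar 11)) (scalar 11))
      (.seq (.store 7 (.get 4 (scalar 11)) (scalar 12))
        (.store 5 (.get 4 (scalar 11)) (.add (scalar 13) (.const 2)))))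
    .skip

/-- Label all groups from which there is an alternating path to group `15`. -/
def search : Loop :=
  .seq (.count 12 1 (.store 5 (scalar 12) (.const 0)))
    (.seq (.store 5 (scalar 15) (.const 1)) (.count 13 1 (.count 11 0 (.count 12 1 relax))))

/-- Move a tuple of group `10` along the pointers. -/
def moveTuple : Loop :=
  .seq (.store 3 (scalar 10) (.sub (.get 3 (scalar 10)) (.const 1)))
    (.seq (.store 3 (.get 7 (scalar 10)) (.add (.get 3 (.get 7 (scalar 10))) (.const 1)))
      (.seq (.store 4 (.get 6 (scalar 10)) (.get 7 (scalar 10)))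
        (.store 10 (.const 0) (.get 7 (scalar 10)))))

/-- Exchange along the labelled path from group `14` to group `15`. -/
def walk : Loop :=
  .seq (.store 10 (.const 0) (scalar 14))
    (.count 13 1 (.ite (.add (.sub (scalar 10) (scalar 15)) (.sub (scalar 15) (scalar 10)))
      moveTuple .skip))

/-- Group `14` is labelled, and a move of one unit from there to group `15` is an improvement. -/
def improveTest : Expr :=
  .mul (.get 5 (scalar 14))
    (.sub (.add (.mul (.get 3 (scalar 14)) (scalar 8)) (.get 9 (scalar 15)))
      (.add (.mul (.add (.get 3 (scalar 15)) (.const 1)) (scalar 8)) (.get 9 (scalar 14))))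

/-- Exchange along an alternating path from group `14` to group `15` if this is possible and an
improvement. -/
def attempt : Loop := .seq search (.ite improveTest walk .skip)

/-- Try all pairs of groups. -/
def sweep : Loop := .count 14 1 (.count 15 1 attempt)

/-- The whole algorithm. -/
def program : Loop :=
  .seq initDenom (.seq initMean (.seq initWorld (.seq initAnswer
    (.seq (.count 16 0 (.count 17 0 (.count 18 1 sweep))) sweep))))

/-- This syntactic check is the whole complexity analysis of the concrete program. -/
theorem program_wellFormed : program.wellFormed = true := by decide

@[simp] theorem scalar_eval (σ : State) (a : ℕ) : (scalar a).eval σ = σ a 0 := rfl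

@[simp] theorem entry_eval (σ : State) (a i j : ℕ) :
    (entry a i j).eval σ = σ a (σ i 0 * σ 0 1 + σ j 0) := rfl

/-! ### The search -/

section

variable (n m : ℕ) (A W : ℕ → ℕ)

/-- Some tuple of group `u` in the world `W` may also take group `v`. -/
def Move (u v : ℕ) : Prop := ∃ i < n, v < m ∧ W i = u ∧ A (i * m + v) ≠ 0

/-- Labelled groups other than `k` have a pointer to a group with a smaller label. -/
structure Labels (k b : ℕ) (L P Q : ℕ → ℕ) : Prop where
  target : L k ≠ 0
  le : ∀ v < m, L v ≠ 0 → L v ≤ b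
  next : ∀ v < m, L v ≠ 0 → v ≠ k → P v < n ∧ Q v < m ∧ W (P v) = v ∧
    A (P v * m + Q v) ≠ 0 ∧ L (Q v) ≠ 0 ∧ L (Q v) < L v

/-- Every group from which a tuple may move to a labelled group is labelled. -/
def Closed (L : ℕ → ℕ) : Prop :=
  ∀ i < n, ∀ v < m, A (i * m + v) ≠ 0 → L v ≠ 0 → L (W i) ≠ 0

/-- The situation in a round of the search that started with the labels `L₀`, when the pairs in
`S` have been treated. -/
structure Round (k t : ℕ) (L₀ : ℕ → ℕ) (S : ℕ → ℕ → Prop) (L P Q : ℕ → ℕ) : Prop where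
  labels : Labels n m A W k (t + 2) L P Q
  keep : ∀ v, L₀ v ≠ 0 → L v = L₀ v
  closed : Closed n m A W L₀ → ∀ v < m, L v ≠ 0 → L₀ v ≠ 0
  done : ∀ i < n, ∀ v < m, S i v → A (i * m + v) ≠ 0 → L₀ v ≠ 0 → L (W i) ≠ 0

end

variable {n m : ℕ} {A W : ℕ → ℕ}

theorem Round.mono {k t : ℕ} {L₀ L P Q : ℕ → ℕ} {S S' : ℕ → ℕ → Prop}
    (h : Round n m A W k t L₀ S L P Q) (hS : ∀ i v, i < n → v < m → S' i v → S i v) :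
    Round n m A W k t L₀ S' L P Q :=
  ⟨h.labels, h.keep, h.closed, fun i hi v hv hs => h.done i hi v hv (hS i v hi hv hs)⟩

/-- Since `W i` had no label, nothing old is overwritten, and `L v < t + 2` makes the new pointer
descend. Closed initial labels would already have labelled `W i`. -/
theorem Round.relax {k t i v : ℕ} {L₀ L P Q : ℕ → ℕ} {S : ℕ → ℕ → Prop}
    (h : Round n m A W k t L₀ S L P Q) (hi : i < n) (hv : v < m)
    (hA : A (i * m + v) ≠ 0) (hLv : L v ≠ 0) (hLt : L v < t + 2) (hW : L (W i) = 0) :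
    Round n m A W k t L₀ S (Function.update L (W i) (t + 2)) (Function.update P (W i) i)
      (Function.update Q (W i) v) := by
  have hne : ∀ x, L x ≠ 0 → Function.update L (W i) (t + 2) x = L x := fun x hx =>
    Function.update_of_ne (by rintro rfl; exact hx hW) _ _
  refine ⟨⟨?_, fun x hx hLx => ?_, fun x hx hLx hxk => ?_⟩, fun x hx => ?_, fun hc x hx hLx => ?_,
    fun a ha x hx hs hA' hL => ?_⟩
  · rw [hne _ h.labels.target]
    exact h.labels.target
  · by_cases hxW : x = W i
    · simp [hxW]
    · rw [Function.update_of_ne hxW] at hLx ⊢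
      exact h.labels.le x hx hLx
  · by_cases hxW : x = W i
    · subst hxW
      simp only [Function.update_self]
      rw [hne v hLv]
      exact ⟨hi, hv, trivial, hA, hLv, hLt⟩
    · rw [Function.update_of_ne hxW] at hLx
      rw [Function.update_of_ne hxW, Function.update_of_ne hxW, Function.update_of_ne hxW]
      obtain ⟨h1, h2, h3, h4, h5, h6⟩ := h.labels.next x hx hLx hxk
      rw [hne _ h5]
      exact ⟨h1, h2, h3, h4, h5, h6⟩
  · have := h.keep x hx
    rw [hne _ (by omega), this]
  · by_cases hxW : x = W i
    · exact absurd hW (by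
        have := h.closed hc v hv hLv
        have h2 := hc i hi v hv hA this
        rw [h.keep _ h2]
        exact h2)
    · rw [Function.update_of_ne hxW] at hLx
      exact h.closed hc x hx hLx
  · have := h.done a ha x hx hs hA' hL
    rw [hne _ this]
    exact this

theorem relax_spec {σ : State} {k : ℕ} {L₀ : ℕ → ℕ} {S : ℕ → ℕ → Prop} (h1 : σ 0 1 = m)
    (hi : σ 11 0 < n) (hv : σ 12 0 < m) (hL₀ : ∀ v < m, L₀ v ≠ 0 → L₀ v < σ 13 0 + 2)
    (h : Round n m (σ 1) (σ 4) k (σ 13 0) L₀ S (σ 5) (σ 6) (σ 7)) :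
    Round n m (σ 1) (σ 4) k (σ 13 0) L₀ (fun i v => S i v ∨ i = σ 11 0 ∧ v = σ 12 0)
      (relax.run σ 5) (relax.run σ 6) (relax.run σ 7) := by
  have key : ∀ L P Q, Round n m (σ 1) (σ 4) k (σ 13 0) L₀ S L P Q →
      (σ 1 (σ 11 0 * m + σ 12 0) ≠ 0 → L₀ (σ 12 0) ≠ 0 → L (σ 4 (σ 11 0)) ≠ 0) →
      Round n m (σ 1) (σ 4) k (σ 13 0) L₀ (fun i v => S i v ∨ i = σ 11 0 ∧ v = σ 12 0) L P Q := by
    intro L P Q hR hd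
    refine ⟨hR.labels, hR.keep, hR.closed, ?_⟩
    rintro i hi v hv (hs | ⟨rfl, rfl⟩)
    · exact hR.done i hi v hv hs
    · exact hd
  by_cases ht : relaxTest.eval σ = 0
  · have hr : Rounding.relax.run σ = σ := by simp [Rounding.relax, Loop.run, ht]
    rw [hr]
    -- An old label is below `σ 13 0 + 2`, so with `hA` and `hL` the test can only vanish because
    -- the group of tuple `11` is labelled already.
    refine key _ _ _ h fun hA hL hW => ?_
    have := h.keep _ hL
    have := hL₀ _ hv hL
    simp only [relaxTest, Expr.eval, entry_eval, scalar_eval, mul_eq_zero, h1] at ht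
    omega
  · have h5 : Rounding.relax.run σ 5 = Function.update (σ 5) (σ 4 (σ 11 0)) (σ 13 0 + 2) := by
      simp [Rounding.relax, Loop.run, ht, State.set, Expr.eval]
    have h6 : Rounding.relax.run σ 6 = Function.update (σ 6) (σ 4 (σ 11 0)) (σ 11 0) := by
      simp [Rounding.relax, Loop.run, ht, State.set, Expr.eval]
    have h7 : Rounding.relax.run σ 7 = Function.update (σ 7) (σ 4 (σ 11 0)) (σ 12 0) := by
      simp [Rounding.relax, Loop.run, ht, State.set, Expr.eval]
    rw [h5, h6, h7]
    simp only [relaxTest, Expr.eval, entry_eval, scalar_eval, mul_eq_zero, h1, not_or] at ht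
    refine key _ _ _ (h.relax hi hv ht.1.1 ht.1.2 (by omega) (by omega)) fun _ _ => ?_
    simp

theorem round_spec {σ : State} {k : ℕ} (h0 : σ 0 0 = n) (h1 : σ 0 1 = m)
    (h : Labels n m (σ 1) (σ 4) k (σ 13 0 + 1) (σ 5) (σ 6) (σ 7)) :
    let τ := (Loop.count 11 0 (.count 12 1 relax)).run σ
    Round n m (σ 1) (σ 4) k (σ 13 0) (σ 5) (fun _ _ => True) (τ 5) (τ 6) (τ 7) := by
  have := Loop.run_count (v := 11) (x := 0) (c := .count 12 1 relax) (σ := σ)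
    (fun a τ => Round n m (σ 1) (σ 4) k (σ 13 0) (σ 5) (fun i _ => i < a) (τ 5) (τ 6) (τ 7))
    (by decide) (fun a τ y h => by simpa [State.set] using h)
    ⟨⟨h.target, fun v hv hL => (h.le v hv hL).trans (by omega), h.next⟩, fun _ _ => rfl,
      fun _ _ _ h => h, fun i _ v _ hs => absurd hs (by omega)⟩ ?_
  · rw [h0] at this
    exact this.mono fun i v hi _ _ => hi
  · rintro a ha τ hf rfl hR
    have f0 := hf 0 (by decide) (by decide)
    have f1 := hf 1 (by decide) (by decide)
    have f4 := hf 4 (by decide) (by decide)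
    have f13 := hf 13 (by decide) (by decide)
    have := Loop.run_count (v := 12) (x := 1) (c := relax) (σ := τ)
      (fun b υ => Round n m (σ 1) (σ 4) k (σ 13 0) (σ 5)
        (fun i v => i < τ 11 0 ∨ i = τ 11 0 ∧ v < b) (υ 5) (υ 6) (υ 7))
      (by decide) (fun a τ y h => by simpa [State.set] using h)
      (hR.mono fun i v _ _ => by omega) ?_
    · rw [f0, h1] at this
      exact this.mono fun i v _ _ _ => by omega
    · rintro b hb υ hg rfl hR'
      have g0 := hg 0 (by decide) (by decide)
      have g1 := hg 1 (by decide) (by decide)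
      have g4 := hg 4 (by decide) (by decide)
      have g11 := hg 11 (by decide) (by decide)
      have g13 := hg 13 (by decide) (by decide)
      rw [f0, h1] at hb
      rw [← f1, ← g1, ← f4, ← g4, ← f13, ← g13] at hR' ⊢
      refine (relax_spec (by rw [g0, f0, h1]) (by rw [g11]; omega) hb
        (fun v hv hL => ?_) hR').mono fun i v _ _ => ?_
      · rw [g13, f13]
        have := h.le v hv hL
        omega
      · rw [g11]
        omega

/-- A round that labels nothing new proves closure, and there are only `m` groups to label. The
count starts at one with the target, so `m` rounds suffice. -/
theorem search_spec {σ : State} (h0 : σ 0 0 = n) (h1 : σ 0 1 = m) (hk : σ 15 0 < m) :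
    let τ := search.run σ
    Labels n m (σ 1) (σ 4) (σ 15 0) (m + 1) (τ 5) (τ 6) (τ 7) ∧
      Closed n m (σ 1) (σ 4) (τ 5) := by
  have hclear := Loop.run_count (v := 12) (x := 1) (c := .store 5 (scalar 12) (.const 0)) (σ := σ)
    (fun a τ => ∀ v < a, τ 5 v = 0) (by decide) (fun a τ y h => by simpa [State.set] using h)
    (by simp) (by
      rintro a ha τ - rfl h v hv
      simp only [Loop.run, scalar_eval, Expr.eval, State.set_apply_self, Function.update_apply]
      split_ifs
      · rfl
      · exact h v (by omega))
  rw [h1] at hclear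
  unfold search
  simp only [Loop.run.eq_3]
  set ρ := (Loop.count 12 1 (.store 5 (scalar 12) (.const 0))).run σ with hρ
  have hρf : ∀ a, a ≠ 12 → a ≠ 5 → ρ a = σ a := fun a h h' =>
    Loop.run_of_notMem_writes _ _ (by simp [Loop.writes, h, h'])
  set π := (Loop.store 5 (scalar 15) (.const 1)).run ρ with hπ
  have hπf : ∀ a, a ≠ 12 → a ≠ 5 → π a = σ a := fun a h h' => by
    rw [hπ, Loop.run_of_notMem_writes _ _ (by simp [Loop.writes, h']), hρf a h h']
  have hπ5 : ∀ v < m, π 5 v = if v = σ 15 0 then 1 else 0 := by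
    intro v hv
    simp only [hπ, Loop.run, scalar_eval, Expr.eval, State.set_apply_self,
      Function.update_apply, hρf 15 (by decide) (by decide)]
    split_ifs
    · rfl
    · exact hclear v hv
  have p0 := hπf 0 (by decide) (by decide)
  have p1 := hπf 1 (by decide) (by decide)
  have p4 := hπf 4 (by decide) (by decide)
  have := Loop.run_count (v := 13) (x := 1) (c := .count 11 0 (.count 12 1 relax)) (σ := π)
    (fun t τ => Labels n m (σ 1) (σ 4) (σ 15 0) (t + 1) (τ 5) (τ 6) (τ 7) ∧
      (Closed n m (σ 1) (σ 4) (τ 5) ∨ t + 1 ≤ ((Finset.range m).filter fun v => τ 5 v ≠ 0).card))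
    (by decide) (fun a τ y h => by simpa [State.set] using h) ?_ ?_
  · rw [p0, h1] at this
    refine ⟨this.1, this.2.resolve_right fun h => ?_⟩
    have := h.trans (Finset.card_filter_le _ _)
    rw [Finset.card_range] at this
    omega
  · refine ⟨⟨by simp [hπ5 _ hk], fun v hv _ => ?_, fun v hv hL hvk => ?_⟩, Or.inr ?_⟩
    · rw [hπ5 v hv]
      split_ifs <;> simp
    · simp [hπ5 v hv, hvk] at hL
    · exact Finset.card_pos.2 ⟨σ 15 0, by simp [hk, hπ5 _ hk]⟩
  · rintro t ht τ hf rfl ⟨hL, hc⟩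
    have f0 := (hf 0 (by decide) (by decide)).trans p0
    have f1 := (hf 1 (by decide) (by decide)).trans p1
    have f4 := (hf 4 (by decide) (by decide)).trans p4
    rw [← f1, ← f4] at hL hc ⊢
    have hR := round_spec (by rw [f0, h0]) (by rw [f0, h1]) hL
    refine ⟨hR.labels, ?_⟩
    by_cases hnew : ∀ v < m, (Loop.count 11 0 (.count 12 1 relax)).run τ 5 v ≠ 0 → τ 5 v ≠ 0
    · exact Or.inl fun i hi v hv hA hv' => hR.done i hi v hv trivial hA (hnew v hv hv')
    · push Not at hnew
      obtain ⟨v, hv, hv1, hv2⟩ := hnew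
      right
      -- A new label shows that the labels were not closed before the round, so the counting
      -- alternative held and now gains one.
      have hc' := hc.resolve_left fun hc => hR.closed hc v hv hv1 hv2
      refine Nat.succ_le_of_lt (hc'.trans_lt (Finset.card_lt_card
        ((Finset.ssubset_iff_of_subset fun x hx => ?_).2 ⟨v, ?_, ?_⟩)))
      · simp only [Finset.mem_filter, Finset.mem_range] at hx ⊢
        rw [hR.keep x hx.2]
        exact hx
      · simp [hv, hv1]
      · simp [hv2]

theorem Labels.reachable {k b : ℕ} {L P Q : ℕ → ℕ} (h : Labels n m A W k b L P Q) {v : ℕ}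
    (hv : v < m) (hL : L v ≠ 0) : ReflTransGen (Move n m A W) v k := by
  induction hl : L v using Nat.strong_induction_on generalizing v with
  | _ l ih =>
    rcases eq_or_ne v k with rfl | hvk
    · exact .refl
    · obtain ⟨h1, h2, h3, h4, h5, h6⟩ := h.next v hv hL hvk
      exact (ih _ (hl ▸ h6) h2 h5 rfl).head ⟨_, h1, h2, h3, h4⟩

theorem Closed.ne_zero_of_reachable {L : ℕ → ℕ} (h : Closed n m A W L) {j k : ℕ}
    (hjk : ReflTransGen (Move n m A W) j k) (hk : L k ≠ 0) : L j ≠ 0 := by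
  induction hjk using ReflTransGen.head_induction_on with
  | refl => exact hk
  | head hs _ ih =>
    obtain ⟨i, hi, hv, rfl, hA⟩ := hs
    exact h i hi _ hv hA ih

end Rounding

namespace Rounding

open RAM Relation

/-! ### The exchange -/

section

variable (n m : ℕ) (A : ℕ → ℕ)

/-- The number of tuples of group `v`. -/
def groupCount (W : ℕ → ℕ) (v : ℕ) : ℕ := ((Finset.range n).filter fun i => W i = v).card

/-- `W` is a world of nonzero probability, and `r` is the answer in it. -/
structure IsWorld (W r : ℕ → ℕ) : Prop where
  valid : ∀ i < n, W i < m ∧ A (i * m + W i) ≠ 0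
  count : ∀ v < m, r v = groupCount n W v

/-- The situation after `t` steps of the walk from `j` to `k`, which has come to group `c`. -/
structure Walk (W₀ r₀ L : ℕ → ℕ) (j k t : ℕ) (W r : ℕ → ℕ) (c : ℕ) : Prop where
  world : IsWorld n m A W r
  lt : c < m
  label : L c ≠ 0
  progress : c = k ∨ L c + t ≤ m + 1
  answer : ∀ v < m, r v + (if v = j then 1 else 0) = r₀ v + (if v = c then 1 else 0)
  unmoved : ∀ i < n, L (W₀ i) ≤ L c → W i = W₀ i

end

variable {n m : ℕ} {A : ℕ → ℕ}

theorem groupCount_eq_sum (W : ℕ → ℕ) (v : ℕ) :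
    groupCount n W v = ∑ i ∈ Finset.range n, if W i = v then 1 else 0 := by
  simp [groupCount]

theorem groupCount_update {W : ℕ → ℕ} {i u : ℕ} (hi : i < n) (v : ℕ) :
    groupCount n (Function.update W i u) v + (if v = W i then 1 else 0) =
      groupCount n W v + (if v = u then 1 else 0) := by
  simp only [groupCount_eq_sum]
  rw [← Finset.add_sum_erase _ _ (Finset.mem_range.2 hi),
    ← Finset.add_sum_erase _ (fun x => if W x = v then 1 else 0) (Finset.mem_range.2 hi)]
  have : ∑ x ∈ (Finset.range n).erase i, (if Function.update W i u x = v then 1 else 0) =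
      ∑ x ∈ (Finset.range n).erase i, if W x = v then 1 else 0 :=
    Finset.sum_congr rfl fun x hx => by
      rw [Function.update_of_ne (Finset.ne_of_mem_erase hx)]
  simp only [this, Function.update_self, eq_comm (a := v)]
  ring

theorem groupCount_pos {W : ℕ → ℕ} {i : ℕ} (hi : i < n) : 0 < groupCount n W (W i) :=
  Finset.card_pos.2 ⟨i, by simp [hi]⟩

theorem groupCount_le (W : ℕ → ℕ) (v : ℕ) : groupCount n W v ≤ n :=
  (Finset.card_filter_le _ _).trans_eq (Finset.card_range n)

theorem IsWorld.sum_eq {W r : ℕ → ℕ} (h : IsWorld n m A W r) :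
    ∑ v ∈ Finset.range m, r v = n := by
  rw [Finset.sum_congr rfl fun v hv => h.count v (Finset.mem_range.1 hv)]
  have := Finset.card_eq_sum_card_fiberwise (s := Finset.range n) (t := Finset.range m) (f := W)
    fun i hi => by simpa using (h.valid i (by simpa using hi)).1
  rw [Finset.card_range] at this
  exact this.symm

/-- Only tuples whose original group has a label above `L c` have moved so far. Hence the tuple `P
c` still sits in `c`, and the count there is positive, so the subtraction is exact. -/
theorem Walk.step {W₀ r₀ L P Q W r : ℕ → ℕ} {j k t b c : ℕ} (h : Walk n m A W₀ r₀ L j k t W r c)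
    (hL : Labels n m A W₀ k b L P Q) (hck : c ≠ k) :
    Walk n m A W₀ r₀ L j k (t + 1) (Function.update W (P c) (Q c))
      (Function.update (Function.update r c (r c - 1)) (Q c)
        (Function.update r c (r c - 1) (Q c) + 1)) (Q c) := by
  obtain ⟨hi, hu, hPc, hA, hQ, hlt⟩ := hL.next c h.lt h.label hck
  have hWc : W (P c) = c := by rw [h.unmoved _ hi (by rw [hPc]), hPc]
  have huc : Q c ≠ c := fun he => by rw [he] at hlt; omega
  have hpos : 0 < r c := by
    rw [h.world.count c h.lt]
    have := groupCount_pos (W := W) hi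
    rwa [hWc] at this
  have hr : ∀ v, Function.update (Function.update r c (r c - 1)) (Q c)
        (Function.update r c (r c - 1) (Q c) + 1) v + (if v = c then 1 else 0) =
      r v + (if v = Q c then 1 else 0) := by
    intro v
    simp only [Function.update_apply, huc, if_false]
    by_cases h1 : v = Q c
    · subst h1
      simp [huc]
    · by_cases h2 : v = c
      · subst h2
        simp [h1]
        omega
      · simp [h1, h2]
  refine ⟨⟨fun i hi' => ?_, fun v hv => ?_⟩, hu, hQ, ?_, fun v hv => ?_, fun i hi' hle => ?_⟩
  · by_cases hic : i = P c
    · subst hic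
      simpa using ⟨hu, hA⟩
    · rw [Function.update_of_ne hic]
      exact h.world.valid i hi'
  · have h1 := hr v
    have h2 := groupCount_update (W := W) (u := Q c) hi v
    rw [hWc] at h2
    rw [h.world.count v hv] at h1
    omega
  · have := h.progress
    omega
  · have h1 := hr v
    have h2 := h.answer v hv
    omega
  · rw [Function.update_of_ne]
    · exact h.unmoved i hi' (by omega)
    · rintro rfl
      rw [hPc] at hle
      omega

theorem moveTuple_spec (σ : State) :
    let c := σ 10 0
    let r := Function.update (σ 3) c (σ 3 c - 1)
    moveTuple.run σ 3 = Function.update r (σ 7 c) (r (σ 7 c) + 1) ∧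
      moveTuple.run σ 4 = Function.update (σ 4) (σ 6 c) (σ 7 c) ∧
      moveTuple.run σ 10 0 = σ 7 c := by
  refine ⟨?_, ?_, ?_⟩ <;> simp [moveTuple, Loop.run, State.set, Expr.eval]

/-- Labels decrease strictly along the pointers, so the target is reached within `m` rounds, and
further rounds change nothing. -/
theorem walk_spec {σ : State} (h1 : σ 0 1 = m) (hw : IsWorld n m (σ 1) (σ 4) (σ 3))
    (hL : Labels n m (σ 1) (σ 4) (σ 15 0) (m + 1) (σ 5) (σ 6) (σ 7)) (hj : σ 14 0 < m)
    (hLj : σ 5 (σ 14 0) ≠ 0) :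
    let τ := walk.run σ
    IsWorld n m (σ 1) (τ 4) (τ 3) ∧ ∀ v < m,
      τ 3 v + (if v = σ 14 0 then 1 else 0) = σ 3 v + (if v = σ 15 0 then 1 else 0) := by
  unfold walk
  simp only [Loop.run.eq_3]
  set π := (Loop.store 10 (.const 0) (scalar 14)).run σ with hπ
  have hπf : ∀ a, a ≠ 10 → π a = σ a := fun a h => by
    rw [hπ, Loop.run_of_notMem_writes _ _ (by simp [Loop.writes, h])]
  have hπ10 : π 10 0 = σ 14 0 := by
    simp [hπ, Loop.run, State.set, Expr.eval]
  have := Loop.run_count (v := 13) (x := 1) (c := .ite (.add (.sub (scalar 10) (scalar 15))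
      (.sub (scalar 15) (scalar 10))) moveTuple .skip) (σ := π)
    (fun t τ => Walk n m (σ 1) (σ 4) (σ 3) (σ 5) (σ 14 0) (σ 15 0) t (τ 4) (τ 3) (τ 10 0))
    (by decide) (fun a τ y h => by simpa [State.set] using h) ?_ ?_
  · rw [hπf 0 (by decide), h1] at this
    generalize (Loop.count 13 1 (.ite (.add (.sub (scalar 10) (scalar 15))
      (.sub (scalar 15) (scalar 10))) moveTuple .skip)).run π = τ at this ⊢
    -- Otherwise `progress` after `m` rounds leaves a label of at most one, but a group other than
    -- the target points to a smaller nonzero label.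
    have hk : τ 10 0 = σ 15 0 := by
      by_contra hne
      have h2 := this.progress.resolve_left hne
      have h3 := hL.next _ this.lt this.label hne
      omega
    refine ⟨this.world, fun v hv => ?_⟩
    have := this.answer v hv
    rwa [hk] at this
  · rw [hπ10, hπf 3 (by decide), hπf 4 (by decide)]
    exact ⟨hw, hj, hLj, Or.inr (by simpa using hL.le _ hj hLj), fun _ _ => rfl, fun _ _ _ => rfl⟩
  · rintro t ht τ hf rfl h
    have f5 := (hf 5 (by decide) (by decide)).trans (hπf 5 (by decide))
    have f6 := (hf 6 (by decide) (by decide)).trans (hπf 6 (by decide))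
    have f7 := (hf 7 (by decide) (by decide)).trans (hπf 7 (by decide))
    have f15 := (hf 15 (by decide) (by decide)).trans (hπf 15 (by decide))
    simp only [Loop.run.eq_4, Expr.eval, scalar_eval, f15]
    split_ifs with hc
    · obtain ⟨m3, m4, m10⟩ := moveTuple_spec τ
      rw [m3, m4, m10, f6, f7]
      exact h.step hL (by omega)
    · have hck : τ 10 0 = σ 15 0 := by omega
      exact ⟨h.world, h.lt, h.label, Or.inl hck, h.answer, h.unmoved⟩

/-! ### The potential -/

section

variable (n m : ℕ) (A : ℕ → ℕ) (D : ℕ) (M : ℕ → ℕ)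

/-- A move of one unit from group `j` to group `k` brings the answer `r` closer to the mean. -/
def Improves (r : ℕ → ℕ) (j k : ℕ) : Prop := (r k + 1) * D + M j < r j * D + M k

/-- No exchange along an alternating path brings the answer closer to the mean. -/
def Stuck (W r : ℕ → ℕ) : Prop :=
  ∀ j < m, ∀ k < m, ReflTransGen (Move n m A W) j k → ¬ Improves D M r j k

/-- The number of units, among the first `n` in every group, that are preferable to unit `c + 1`
of group `v`. -/
def rank (v c : ℕ) : ℕ :=
  ((Finset.range m ×ˢ Finset.range n).filter fun x =>
    (x.2 + 1) * D + M v < (c + 1) * D + M x.1).card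

/-- The total rank of all units of an answer. -/
def potential (r : ℕ → ℕ) : ℕ :=
  ∑ v ∈ Finset.range m, ∑ c ∈ Finset.range (r v), rank n m D M v c

end

variable {D : ℕ} {M : ℕ → ℕ}

/-- The unit `(v, c)` itself is counted on the right and not on the left; `hc` ensures that it is
among the units counted at all. -/
theorem rank_lt {v c v' c' : ℕ} (hv : v < m) (hc : c < n)
    (h : (c + 1) * D + M v' < (c' + 1) * D + M v) : rank n m D M v c < rank n m D M v' c' := by
  refine Finset.card_lt_card ((Finset.ssubset_iff_of_subset fun x hx => ?_).2 ⟨(v, c), ?_, ?_⟩)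
  · simp only [Finset.mem_filter] at hx ⊢
    exact ⟨hx.1, by omega⟩
  · simpa [hv, hc] using h
  · simp

/-- The exchange replaces the last unit of `j` by a new last unit of `k` of smaller marginal cost,
hence of smaller rank. -/
theorem potential_lt {W r r' : ℕ → ℕ} {j k : ℕ} (hj : j < m) (hk : k < m)
    (himp : Improves D M r j k) (hw' : IsWorld n m A W r')
    (h : ∀ v < m, r' v + (if v = j then 1 else 0) = r v + (if v = k then 1 else 0)) :
    potential n m D M r' < potential n m D M r := by
  have hjk : j ≠ k := by
    rintro rfl
    unfold Improves at himp
    nlinarith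
  have h1 := h j hj
  have h2 := h k hk
  simp only [if_true, hjk, hjk.symm, if_false, add_zero] at h1 h2
  have hs := sum_exchange (Finset.range m)
    (fun v x => ∑ c ∈ Finset.range x, rank n m D M v c) (r := r) (r' := r')
    (Finset.mem_range.2 hj) (Finset.mem_range.2 hk) hjk
    fun v hv hvj hvk => by simpa [hvj, hvk] using h v (Finset.mem_range.1 hv)
  -- `r' k = r k + 1` counts tuples, so it is at most `n`.
  have hlt : r k < n := by
    have := groupCount_le (n := n) W k
    rw [← hw'.count k hk] at this
    omega
  have hr : rank n m D M k (r k) < rank n m D M j (r' j) := by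
    refine rank_lt hk hlt ?_
    rw [h1]
    exact himp
  rw [← h1, h2, Finset.sum_range_succ, Finset.sum_range_succ] at hs
  unfold potential
  omega

theorem potential_le {W r : ℕ → ℕ} (h : IsWorld n m A W r) :
    potential n m D M r ≤ n * (n * m) := by
  calc potential n m D M r ≤ ∑ v ∈ Finset.range m, r v * (n * m) := by
        refine Finset.sum_le_sum fun v _ => ?_
        refine (Finset.sum_le_card_nsmul _ _ (n * m) fun c _ => ?_).trans_eq (by simp)
        refine (Finset.card_filter_le _ _).trans_eq ?_
        simp [mul_comm]
    _ = n * (n * m) := by rw [← Finset.sum_mul, h.sum_eq]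

/-! ### The local search -/

section

variable (n m : ℕ)

/-- The memory holds the table and a world of nonzero probability with its answer. -/
structure Ready (A : ℕ → ℕ) (D : ℕ) (M : ℕ → ℕ) (σ : State) : Prop where
  rows : σ 0 0 = n
  cols : σ 0 1 = m
  num : σ 1 = A
  denom : σ 8 0 = D
  mean : σ 9 = M
  world : IsWorld n m A (σ 4) (σ 3)

/-- The situation in a sweep that started with the world `W` with answer `r`, when the pairs in
`S` have been treated. -/
def Swept (A : ℕ → ℕ) (D : ℕ) (M W r : ℕ → ℕ) (S : ℕ → ℕ → Prop) (σ : State) : Prop :=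
  Ready n m A D M σ ∧
    ((σ 4 = W ∧ σ 3 = r ∧ ∀ j < m, ∀ k < m, S j k → ReflTransGen (Move n m A W) j k →
      ¬ Improves D M r j k) ∨
    (¬ Stuck n m A D M W r ∧ potential n m D M (σ 3) < potential n m D M r))

end

theorem Ready.congr {σ τ : State} (h : Ready n m A D M σ)
    (he : ∀ a, a ∈ [0, 1, 3, 4, 8, 9] → τ a = σ a) : Ready n m A D M τ := by
  obtain ⟨h1, h2, h3, h4, h5, h6⟩ := h
  constructor
  · rwa [he 0 (by decide)]
  · rwa [he 0 (by decide)]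
  · rwa [he 1 (by decide)]
  · rwa [he 8 (by decide)]
  · rwa [he 9 (by decide)]
  · rwa [he 3 (by decide), he 4 (by decide)]

theorem Ready.set {σ : State} (h : Ready n m A D M σ) {v i y : ℕ} (hv : v ∉ [0, 1, 3, 4, 8, 9]) :
    Ready n m A D M (σ.set v i y) :=
  h.congr fun _ ha => State.set_apply_of_ne _ _ _ (fun h => hv (h ▸ ha))

theorem Swept.set {σ : State} {W r : ℕ → ℕ} {S : ℕ → ℕ → Prop} (h : Swept n m A D M W r S σ)
    {v i y : ℕ} (hv : v ∉ [0, 1, 3, 4, 8, 9]) : Swept n m A D M W r S (σ.set v i y) := by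
  refine ⟨h.1.set hv, ?_⟩
  rw [State.set_apply_of_ne _ _ _ (show 3 ≠ v by rintro rfl; simp at hv),
    State.set_apply_of_ne _ _ _ (show 4 ≠ v by rintro rfl; simp at hv)]
  exact h.2

theorem Swept.mono {σ : State} {W r : ℕ → ℕ} {S S' : ℕ → ℕ → Prop}
    (h : Swept n m A D M W r S σ) (hS : ∀ j k, j < m → k < m → S' j k → S j k) :
    Swept n m A D M W r S' σ :=
  ⟨h.1, h.2.imp_left fun h => ⟨h.1, h.2.1, fun j hj k hk hs => h.2.2 j hj k hk (hS j k hj hk hs)⟩⟩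

/-- Labels give real paths, so a walk shows that the old world was not stuck; closedness gives the
converse, that an unlabelled group has no path to the target. -/
theorem attempt_spec {σ : State} (h : Ready n m A D M σ) (hj : σ 14 0 < m) (hk : σ 15 0 < m) :
    let τ := attempt.run σ
    Ready n m A D M τ ∧
      ((τ 4 = σ 4 ∧ τ 3 = σ 3 ∧ (ReflTransGen (Move n m A (σ 4)) (σ 14 0) (σ 15 0) →
        ¬ Improves D M (σ 3) (σ 14 0) (σ 15 0))) ∨
      (¬ Stuck n m A D M (σ 4) (σ 3) ∧
        potential n m D M (τ 3) < potential n m D M (σ 3))) := by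
  obtain ⟨hL, hC⟩ := search_spec h.rows h.cols hk
  unfold attempt
  simp only [Loop.run.eq_3]
  set π := search.run σ
  have hf : ∀ a, a ∉ search.writes → π a = σ a := fun a ha => Loop.run_of_notMem_writes _ _ ha
  have hπ : Ready n m A D M π := h.congr fun a ha => hf a (by
    have : ∀ a ∈ [0, 1, 3, 4, 8, 9], a ∉ search.writes := by decide
    exact this a ha)
  have f3 := hf 3 (by decide)
  have f4 := hf 4 (by decide)
  have f14 := hf 14 (by decide)
  have f15 := hf 15 (by decide)
  -- A nonzero product expresses a conjunction, and a nonzero truncated difference a strict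
  -- inequality.
  have htest : improveTest.eval π ≠ 0 ↔
      π 5 (σ 14 0) ≠ 0 ∧ Improves D M (σ 3) (σ 14 0) (σ 15 0) := by
    simp only [improveTest, Expr.eval, scalar_eval, mul_ne_zero_iff, f14, f15, f3, hπ.denom,
      hπ.mean, Improves]
    omega
  simp only [Loop.run.eq_4]
  rw [h.num] at hL hC
  split_ifs with ht
  · obtain ⟨hLj, himp⟩ := htest.1 ht
    obtain ⟨hw, ha⟩ := walk_spec hπ.cols (by rw [hπ.num]; exact hπ.world)
      (by rw [hπ.num, f4, f15]; exact hL) (by rw [f14]; exact hj) (by rw [f14]; exact hLj)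
    rw [hπ.num] at hw
    rw [f14, f15, f3] at ha
    have hwf : ∀ a, a ∉ walk.writes → walk.run π a = π a := fun a ha =>
      Loop.run_of_notMem_writes _ _ ha
    refine ⟨⟨?_, ?_, ?_, ?_, ?_, hw⟩, Or.inr ⟨fun hs => ?_, potential_lt hj hk himp hw ha⟩⟩
    · rw [hwf 0 (by decide), hπ.rows]
    · rw [hwf 0 (by decide), hπ.cols]
    · rw [hwf 1 (by decide), hπ.num]
    · rw [hwf 8 (by decide), hπ.denom]
    · rw [hwf 9 (by decide), hπ.mean]
    · exact hs _ hj _ hk (hL.reachable hj hLj) himp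
  · refine ⟨hπ, Or.inl ⟨f4, f3, fun hr himp => ht (htest.2 ⟨?_, himp⟩)⟩⟩
    exact hC.ne_zero_of_reachable hr hL.target

/-- Once the potential has dropped, later attempts never raise it, so pairs need to be remembered
only while the world is unchanged. -/
theorem Swept.attempt {σ : State} {W r : ℕ → ℕ} {S : ℕ → ℕ → Prop}
    (h : Swept n m A D M W r S σ) (hj : σ 14 0 < m) (hk : σ 15 0 < m) :
    Swept n m A D M W r (fun j k => S j k ∨ j = σ 14 0 ∧ k = σ 15 0) (attempt.run σ) := by
  obtain ⟨hR, ha⟩ := attempt_spec h.1 hj hk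
  refine ⟨hR, ?_⟩
  rcases h.2 with ⟨rfl, rfl, hS⟩ | ⟨hs, hlt⟩
  · rcases ha with ⟨h4, h3, hn⟩ | ha
    · refine Or.inl ⟨h4, h3, ?_⟩
      rintro j hj k hk (hs | ⟨rfl, rfl⟩)
      · exact hS j hj k hk hs
      · exact hn
    · exact Or.inr ha
  · refine Or.inr ⟨hs, lt_of_le_of_lt ?_ hlt⟩
    rcases ha with ⟨-, h3, -⟩ | ha
    · rw [h3]
    · exact ha.2.le

theorem sweep_spec {σ : State} (h : Ready n m A D M σ) :
    Swept n m A D M (σ 4) (σ 3) (fun _ _ => True) (sweep.run σ) := by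
  have := Loop.run_count (v := 14) (x := 1) (c := .count 15 1 attempt) (σ := σ)
    (fun a τ => Swept n m A D M (σ 4) (σ 3) (fun j _ => j < a) τ)
    (by decide) (fun a τ y h => h.set (by decide))
    ⟨h, Or.inl ⟨rfl, rfl, fun j _ k _ hs => absurd hs (by omega)⟩⟩ ?_
  · rw [h.cols] at this
    exact this.mono fun j k hj _ _ => hj
  · rintro a ha τ hf rfl hS
    rw [h.cols] at ha
    have := Loop.run_count (v := 15) (x := 1) (c := Rounding.attempt) (σ := τ)
      (fun b υ => Swept n m A D M (σ 4) (σ 3)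
        (fun j k => j < τ 14 0 ∨ j = τ 14 0 ∧ k < b) υ)
      (by decide) (fun a τ y h => h.set (by decide)) (hS.mono fun j k _ _ => by omega) ?_
    · rw [hS.1.cols] at this
      exact this.mono fun j k _ _ _ => by omega
    · rintro b hb υ hg rfl hS'
      rw [hS.1.cols] at hb
      have g14 := hg 14 (by decide) (by decide)
      refine (hS'.attempt (by rwa [g14]) hb).mono fun j k _ _ => ?_
      rw [g14]
      omega

/-- After `t` sweeps, no exchange is an improvement, or the potential has decreased `t` times. -/
def Progress (n m : ℕ) (A : ℕ → ℕ) (D : ℕ) (M : ℕ → ℕ) (t : ℕ) (σ : State) : Prop :=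
  Ready n m A D M σ ∧
    (Stuck n m A D M (σ 4) (σ 3) ∨ potential n m D M (σ 3) + t ≤ n * (n * m))

theorem Progress.set {σ : State} {t : ℕ} (h : Progress n m A D M t σ)
    {v i y : ℕ} (hv : v ∉ [0, 1, 3, 4, 8, 9]) : Progress n m A D M t (σ.set v i y) := by
  refine ⟨h.1.set hv, ?_⟩
  rw [State.set_apply_of_ne _ _ _ (show 3 ≠ v by rintro rfl; simp at hv),
    State.set_apply_of_ne _ _ _ (show 4 ≠ v by rintro rfl; simp at hv)]
  exact h.2

/-- From a stuck world the improving alternative is impossible, so stuckness persists; otherwise the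
potential drops by at least one. -/
theorem Progress.sweep {σ : State} {t : ℕ} (h : Progress n m A D M t σ) :
    Progress n m A D M (t + 1) (sweep.run σ) := by
  obtain ⟨hR, hs⟩ := sweep_spec h.1
  refine ⟨hR, ?_⟩
  rcases hs with ⟨h4, h3, hs⟩ | ⟨hn, hlt⟩
  · left
    rw [h4, h3]
    exact fun j hj k hk => hs j hj k hk trivial
  · right
    have := h.2.resolve_left hn
    omega

theorem Ready.search {σ : State} (h : Ready n m A D M σ) :
    let τ := (Loop.seq (.count 16 0 (.count 17 0 (.count 18 1 sweep))) sweep).run σ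
    Ready n m A D M τ ∧ Stuck n m A D M (τ 4) (τ 3) := by
  have := Loop.run_count (v := 16) (x := 0) (c := .count 17 0 (.count 18 1 Rounding.sweep)) (σ := σ)
    (fun a τ => Progress n m A D M (a * (n * m)) τ)
    (by decide) (fun a τ y h => h.set (by decide))
    ⟨h, Or.inr (by simpa using potential_le h.world)⟩ ?_
  · rw [h.rows] at this
    have := this.sweep
    -- The final sweep is number `n * (n * m) + 1`, one more than the potential permits.
    exact ⟨this.1, this.2.resolve_right (by omega)⟩
  · rintro a ha τ - - hτ
    have := Loop.run_count (v := 17) (x := 0) (c := .count 18 1 Rounding.sweep) (σ := τ)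
      (fun b υ => Progress n m A D M (a * (n * m) + b * m) υ)
      (by decide) (fun a τ y h => h.set (by decide)) (by simpa using hτ) ?_
    · rw [hτ.1.rows] at this
      rwa [add_mul, one_mul]
    · rintro b hb υ - - hυ
      have := Loop.run_count (v := 18) (x := 1) (c := Rounding.sweep) (σ := υ)
        (fun c ρ => Progress n m A D M (a * (n * m) + b * m + c) ρ)
        (by decide) (fun a τ y h => h.set (by decide)) (by simpa using hυ)
        fun c hc ρ _ _ hρ => hρ.sweep
      rw [hυ.1.cols] at this
      rwa [add_mul b, one_mul, ← add_assoc]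

end Rounding

namespace Rounding

open RAM Relation

variable {n m : ℕ}

/-! ### The initialization -/

/-- The scalar is the product of all denominators; a least common multiple is not needed, since the
product already has polynomial length. -/
theorem initDenom_spec {σ : State} (h0 : σ 0 0 = n) (h1 : σ 0 1 = m)
    (hB : ∀ i < n, ∀ v < m, σ 2 (i * m + v) ≠ 0) :
    let τ := initDenom.run σ
    τ 8 0 ≠ 0 ∧ ∀ i < n, ∀ v < m, σ 2 (i * m + v) ∣ τ 8 0 := by
  unfold initDenom
  simp only [Loop.run.eq_3]
  set π := (Loop.store 8 (.const 0) (.const 1)).run σ with hπ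
  have hπf : ∀ a, a ≠ 8 → π a = σ a := fun a h => by
    rw [hπ, Loop.run_of_notMem_writes _ _ (by simp [Loop.writes, h])]
  have hπ8 : π 8 0 = 1 := by simp [hπ, Loop.run, State.set, Expr.eval]
  have p0 := hπf 0 (by decide)
  have := Loop.run_count (v := 11) (x := 0)
    (c := .count 12 1 (.store 8 (.const 0) (.mul (scalar 8) (entry 2 11 12)))) (σ := π)
    (fun a τ => τ 8 0 ≠ 0 ∧ ∀ i < n, ∀ v < m, i < a → σ 2 (i * m + v) ∣ τ 8 0)
    (by decide) (fun a τ y h => by simpa [State.set] using h)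
    ⟨by simp [hπ8], fun _ _ _ _ h => absurd h (by omega)⟩ ?_
  · rw [p0, h0] at this
    exact ⟨this.1, fun i hi v hv => this.2 i hi v hv hi⟩
  · rintro a ha τ hf rfl ⟨hne, hd⟩
    have f0 := (hf 0 (by decide) (by decide)).trans p0
    have f2 := (hf 2 (by decide) (by decide)).trans (hπf 2 (by decide))
    rw [p0, h0] at ha
    have := Loop.run_count (v := 12) (x := 1)
      (c := .store 8 (.const 0) (.mul (scalar 8) (entry 2 11 12))) (σ := τ)
      (fun b υ => υ 8 0 ≠ 0 ∧ ∀ i < n, ∀ v < m, i < τ 11 0 ∨ i = τ 11 0 ∧ v < b →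
        σ 2 (i * m + v) ∣ υ 8 0)
      (by decide) (fun a τ y h => by simpa [State.set] using h)
      ⟨hne, fun i hi v hv h => hd i hi v hv (by omega)⟩ ?_
    · rw [f0, h1] at this
      exact ⟨this.1, fun i hi v hv h => this.2 i hi v hv (by omega)⟩
    · rintro b hb υ hg rfl ⟨hne, hd⟩
      have g0 := (hg 0 (by decide) (by decide)).trans f0
      have g2 := (hg 2 (by decide) (by decide)).trans f2
      have g11 := hg 11 (by decide) (by decide)
      rw [f0, h1] at hb
      have he : (Loop.store 8 (.const 0) (.mul (scalar 8) (entry 2 11 12))).run υ 8 0 =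
          υ 8 0 * σ 2 (τ 11 0 * m + υ 12 0) := by
        simp [Loop.run, State.set, Expr.eval, g0, g2, g11, h1]
      rw [he]
      refine ⟨mul_ne_zero hne (hB _ ha _ hb), fun i hi v hv h => ?_⟩
      by_cases hiv : i = τ 11 0 ∧ v = υ 12 0
      · rw [hiv.1, hiv.2]
        exact Dvd.intro_left _ rfl
      · exact (hd i hi v hv (by omega)).mul_right _

theorem initMean_spec {σ : State} (h0 : σ 0 0 = n) (h1 : σ 0 1 = m) (h9 : ∀ v, σ 9 v = 0) :
    ∀ v < m, initMean.run σ 9 v =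
      ∑ i ∈ Finset.range n, σ 1 (i * m + v) * (σ 8 0 / σ 2 (i * m + v)) := by
  have := Loop.run_count (v := 12) (x := 1) (c := .count 11 0 (.store 9 (scalar 12)
      (.add (.get 9 (scalar 12)) (.mul (entry 1 11 12) (.div (scalar 8) (entry 2 11 12))))))
    (σ := σ)
    (fun b τ => ∀ v, τ 9 v = if v < b then
      ∑ i ∈ Finset.range n, σ 1 (i * m + v) * (σ 8 0 / σ 2 (i * m + v)) else 0)
    (by decide) (fun a τ y h => by simpa [State.set] using h) (by simpa using h9) ?_
  · intro v hv
    refine (this v).trans ?_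
    rw [h1, if_pos hv]
  · rintro b hb τ hf rfl hτ
    have f0 := hf 0 (by decide) (by decide)
    have f1 := hf 1 (by decide) (by decide)
    have f2 := hf 2 (by decide) (by decide)
    have f8 := hf 8 (by decide) (by decide)
    have := Loop.run_count (v := 11) (x := 0) (c := .store 9 (scalar 12)
        (.add (.get 9 (scalar 12)) (.mul (entry 1 11 12) (.div (scalar 8) (entry 2 11 12)))))
      (σ := τ)
      (fun a υ => ∀ v, υ 9 v = if v < τ 12 0 then
        ∑ i ∈ Finset.range n, σ 1 (i * m + v) * (σ 8 0 / σ 2 (i * m + v)) else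
        if v = τ 12 0 then
          ∑ i ∈ Finset.range a, σ 1 (i * m + v) * (σ 8 0 / σ 2 (i * m + v)) else 0)
      (by decide) (fun a τ y h => by simpa [State.set] using h) (by simpa using hτ) ?_
    · rw [f0, h0] at this
      intro v
      rw [this v]
      split_ifs <;> first | rfl | omega
    · rintro a ha υ hg rfl hυ v
      have g0 := (hg 0 (by decide) (by decide)).trans f0
      have g1 := (hg 1 (by decide) (by decide)).trans f1
      have g2 := (hg 2 (by decide) (by decide)).trans f2
      have g8 := (hg 8 (by decide) (by decide)).trans f8
      have g12 := hg 12 (by decide) (by decide)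
      simp only [Loop.run, State.set_apply_self, Function.update_apply, Expr.eval, scalar_eval,
        entry_eval, g0, g1, g2, g8, g12, h1]
      by_cases hv : v = τ 12 0
      · subst hv
        rw [if_pos rfl, hυ, if_neg (lt_irrefl _), if_pos rfl, if_neg (lt_irrefl _), if_pos rfl,
          Finset.sum_range_succ]
      · rw [if_neg hv, hυ, if_neg hv, if_neg hv]

theorem initWorld_spec {σ : State} (h0 : σ 0 0 = n) (h1 : σ 0 1 = m)
    (hA : ∀ i < n, ∃ v < m, σ 1 (i * m + v) ≠ 0) :
    ∀ i < n, initWorld.run σ 4 i < m ∧ σ 1 (i * m + initWorld.run σ 4 i) ≠ 0 := by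
  have := Loop.run_count (v := 11) (x := 0)
    (c := .count 12 1 (.ite (entry 1 11 12) (.store 4 (scalar 11) (scalar 12)) .skip)) (σ := σ)
    (fun a τ => ∀ i < a, τ 4 i < m ∧ σ 1 (i * m + τ 4 i) ≠ 0)
    (by decide) (fun a τ y h => by simpa [State.set] using h) (by simp) ?_
  · rwa [h0] at this
  · rintro a ha τ hf rfl hτ
    have f0 := hf 0 (by decide) (by decide)
    have f1 := hf 1 (by decide) (by decide)
    rw [h0] at ha
    have := Loop.run_count (v := 12) (x := 1)
      (c := .ite (entry 1 11 12) (.store 4 (scalar 11) (scalar 12)) .skip) (σ := τ)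
      -- The entry of the current row is claimed to be valid only after a nonzero probability has
      -- been met; `hA` guarantees one in each row.
      (fun b υ => (∀ i < τ 11 0, υ 4 i < m ∧ σ 1 (i * m + υ 4 i) ≠ 0) ∧
        ∀ v < b, σ 1 (τ 11 0 * m + v) ≠ 0 →
          υ 4 (τ 11 0) < m ∧ σ 1 (τ 11 0 * m + υ 4 (τ 11 0)) ≠ 0)
      (by decide) (fun a τ y h => by simpa [State.set] using h) ⟨hτ, by simp⟩ ?_
    · rw [f0, h1] at this
      intro i hi
      rcases Nat.lt_succ_iff_lt_or_eq.1 hi with hi | rfl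
      · exact this.1 i hi
      · obtain ⟨v, hv, hv'⟩ := hA _ ha
        exact this.2 v hv hv'
    · rintro b hb υ hg rfl ⟨hυ, hυ'⟩
      have g0 := (hg 0 (by decide) (by decide)).trans f0
      have g1 := (hg 1 (by decide) (by decide)).trans f1
      have g11 := hg 11 (by decide) (by decide)
      rw [f0, h1] at hb
      have he : (entry 1 11 12).eval υ = σ 1 (τ 11 0 * m + υ 12 0) := by
        rw [entry_eval, g0, g1, g11, h1]
      simp only [Loop.run.eq_4]
      split_ifs with ht
      · rw [he] at ht
        simp only [Loop.run, State.set_apply_self, scalar_eval, g11]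
        refine ⟨fun i hi => ?_, fun v hv _ => ?_⟩
        · rw [Function.update_of_ne (by omega)]
          exact hυ i hi
        · rw [Function.update_self]
          exact ⟨hb, ht⟩
      · rw [he] at ht
        refine ⟨hυ, fun v hv hv' => ?_⟩
        rcases Nat.lt_succ_iff_lt_or_eq.1 hv with hv | rfl
        · exact hυ' v hv hv'
        · exact absurd hv' ht

theorem initAnswer_spec {σ : State} (h0 : σ 0 0 = n) (h3 : ∀ v, σ 3 v = 0) (v : ℕ) :
    initAnswer.run σ 3 v = groupCount n (σ 4) v := by
  have := Loop.run_count (v := 11) (x := 0) (c := .store 3 (.get 4 (scalar 11))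
      (.add (.get 3 (.get 4 (scalar 11))) (.const 1))) (σ := σ)
    (fun a τ => ∀ v, τ 3 v = groupCount a (σ 4) v)
    (by decide) (fun a τ y h => by simpa [State.set] using h) (by simp [h3, groupCount]) ?_
  · rw [h0] at this
    exact this v
  · rintro a - τ hf rfl hτ v
    have f4 := hf 4 (by decide) (by decide)
    rw [groupCount_eq_sum, Finset.sum_range_succ, ← groupCount_eq_sum, ← hτ]
    simp only [Loop.run, State.set_apply_self, Function.update_apply, Expr.eval, scalar_eval, f4]
    split_ifs with h h' h'
    · rw [h]
    · exact absurd h.symm h'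
    · exact absurd h'.symm h
    · rfl

theorem program_spec {σ : State} (h0 : σ 0 0 = n) (h1 : σ 0 1 = m)
    (h3 : ∀ v, σ 3 v = 0) (h9 : ∀ v, σ 9 v = 0)
    (hA : ∀ i < n, ∃ v < m, σ 1 (i * m + v) ≠ 0)
    (hB : ∀ i < n, ∀ v < m, σ 2 (i * m + v) ≠ 0) :
    ∃ D M, D ≠ 0 ∧ (∀ i < n, ∀ v < m, σ 2 (i * m + v) ∣ D) ∧
      (∀ v < m, M v = ∑ i ∈ Finset.range n, σ 1 (i * m + v) * (D / σ 2 (i * m + v))) ∧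
      let τ := program.run σ
      IsWorld n m (σ 1) (τ 4) (τ 3) ∧ Stuck n m (σ 1) D M (τ 4) (τ 3) := by
  obtain ⟨hD, hdvd⟩ := initDenom_spec h0 h1 hB
  unfold program
  simp only [Loop.run.eq_3]
  set σ₁ := initDenom.run σ
  have e1 : ∀ a, a ∉ initDenom.writes → σ₁ a = σ a := fun a => Loop.run_of_notMem_writes _ _
  have hmean := initMean_spec (σ := σ₁) (by rw [e1 0 (by decide), h0])
    (by rw [e1 0 (by decide), h1]) (by rw [e1 9 (by decide)]; exact h9)
  rw [e1 1 (by decide), e1 2 (by decide)] at hmean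
  set σ₂ := initMean.run σ₁
  have e2 : ∀ a, a ∉ initMean.writes → σ₂ a = σ₁ a := fun a => Loop.run_of_notMem_writes _ _
  have t2 : ∀ a, a ∉ initMean.writes ++ initDenom.writes → σ₂ a = σ a := fun a ha => by
    rw [List.mem_append, not_or] at ha
    rw [e2 a ha.1, e1 a ha.2]
  have hworld := initWorld_spec (n := n) (m := m) (σ := σ₂) (by rw [t2 0 (by decide), h0])
    (by rw [t2 0 (by decide), h1]) (by rw [t2 1 (by decide)]; exact hA)
  rw [t2 1 (by decide)] at hworld
  set σ₃ := initWorld.run σ₂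
  have e3 : ∀ a, a ∉ initWorld.writes → σ₃ a = σ₂ a := fun a => Loop.run_of_notMem_writes _ _
  have hanswer := initAnswer_spec (n := n) (σ := σ₃)
    (by rw [e3 0 (by decide), t2 0 (by decide), h0])
    (by rw [e3 3 (by decide), t2 3 (by decide)]; exact h3)
  set σ₄ := initAnswer.run σ₃
  have e4 : ∀ a, a ∉ initAnswer.writes → σ₄ a = σ₃ a := fun a => Loop.run_of_notMem_writes _ _
  have hready : Ready n m (σ 1) (σ₁ 8 0) (σ₂ 9) σ₄ := by
    constructor
    · rw [e4 0 (by decide), e3 0 (by decide), t2 0 (by decide), h0]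
    · rw [e4 0 (by decide), e3 0 (by decide), t2 0 (by decide), h1]
    · rw [e4 1 (by decide), e3 1 (by decide), t2 1 (by decide)]
    · rw [e4 8 (by decide), e3 8 (by decide), e2 8 (by decide)]
    · rw [e4 9 (by decide), e3 9 (by decide)]
    · rw [e4 4 (by decide)]
      exact ⟨hworld, fun v _ => hanswer v⟩
  obtain ⟨hr, hs⟩ := hready.search
  exact ⟨σ₁ 8 0, σ₂ 9, hD, hdvd, hmean, hr.world, hs⟩

end Rounding

namespace ProbTable

open Relation Rounding

variable {n m : ℕ} (T : ProbTable n m)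

/-! ### The input -/

/-- Division with remainder by `m` makes the row-major index injective, so one summand survives. -/
theorem sum_index {M : Type*} [AddCommMonoid M] (f : Fin n → Fin m → M) (i : Fin n) (j : Fin m) :
    (∑ i' : Fin n, ∑ j' : Fin m, if (i * m + j : ℕ) = i' * m + j' then f i' j' else 0) = f i j := by
  have hinj : ∀ (i' : Fin n) (j' : Fin m), (i * m + j : ℕ) = i' * m + j' → i = i' ∧ j = j' := by
    intro i' j' h
    have hm : 0 < m := j.pos
    have h1 := congrArg (· / m) h
    have h2 := congrArg (· % m) h
    simp only [mul_comm _ m, Nat.mul_add_div hm, Nat.div_eq_of_lt j.2, Nat.div_eq_of_lt j'.2,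
      Nat.mul_add_mod, Nat.mod_eq_of_lt j.2, Nat.mod_eq_of_lt j'.2, add_zero] at h1 h2
    exact ⟨Fin.ext h1, Fin.ext h2⟩
  rw [Finset.sum_eq_single i, Finset.sum_eq_single j]
  · simp
  · intro j' _ hj'
    rw [if_neg fun h => hj' (hinj i j' h).2.symm]
  · simp
  · intro i' _ hi'
    refine Finset.sum_eq_zero fun j' _ => ?_
    rw [if_neg fun h => hi' (hinj i' j' h).1.symm]
  · simp

theorem input_num (i : Fin n) (j : Fin m) : T.input 1 (i * m + j) = (T.p i j).num.toNat :=
  sum_index (fun i j => (T.p i j).num.toNat) i j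

theorem input_den (i : Fin n) (j : Fin m) : T.input 2 (i * m + j) = (T.p i j).den :=
  sum_index (fun i j => (T.p i j).den) i j

theorem input_num_ne_zero_iff (i : Fin n) (j : Fin m) :
    T.input 1 (i * m + j) ≠ 0 ↔ T.p i j ≠ 0 := by
  rw [input_num, Ne, Int.toNat_eq_zero]
  have := Rat.num_nonneg.2 (T.nonneg i j)
  rw [← Rat.num_ne_zero]
  omega

theorem size_sum_index_le {f : Fin n → Fin m → ℕ} {N : ℕ} (hf : ∀ i j, (f i j).size ≤ N) (x : ℕ) :
    (∑ i : Fin n, ∑ j : Fin m, if x = i * m + j then f i j else 0).size ≤ N := by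
  by_cases h : ∃ (i : Fin n) (j : Fin m), x = i * m + j
  · obtain ⟨i, j, rfl⟩ := h
    rw [sum_index]
    exact hf i j
  · push Not at h
    simp [h]

theorem entry_size_le (i : Fin n) (j : Fin m) :
    (T.p i j).num.toNat.size + (T.p i j).den.size ≤ T.size := by
  refine le_trans ?_ (Nat.le_add_left _ _)
  refine le_trans ?_ (Finset.single_le_sum (fun i _ => Nat.zero_le _) (Finset.mem_univ i))
  exact Finset.single_le_sum
    (f := fun j => (T.p i j).num.toNat.size + (T.p i j).den.size)
    (fun j _ => Nat.zero_le _) (Finset.mem_univ j)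

theorem add_le_size : n + m ≤ T.size := Nat.le_add_right _ _

theorem _root_.Nat.size_le_self (a : ℕ) : a.size ≤ a := by
  rw [Nat.size_le]
  exact a.lt_two_pow_self

theorem input_bounded : T.input.Bounded T.size 0 := by
  have hs := T.add_le_size
  refine ⟨fun a ha x => ?_, fun a ha x => ?_⟩
  · interval_cases a
    · simp only [input, if_true]
      split_ifs
      · exact (Nat.size_le_self n).trans (by omega)
      · exact (Nat.size_le_self m).trans (by omega)
      · simp
    · exact size_sum_index_le (fun i j => (Nat.le_add_right _ _).trans (T.entry_size_le i j)) x
    · exact size_sum_index_le (fun i j => (Nat.le_add_left _ _).trans (T.entry_size_le i j)) x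
  · simp [input, show a ≠ 0 by omega, show a ≠ 1 by omega, show a ≠ 2 by omega]

/-! ### The output -/

theorem mean_mul_denom {D : ℕ} {M : ℕ → ℕ}
    (hdvd : ∀ i < n, ∀ v < m, T.input 2 (i * m + v) ∣ D)
    (hM : ∀ v < m, M v = ∑ i ∈ Finset.range n, T.input 1 (i * m + v) *
      (D / T.input 2 (i * m + v))) (j : Fin m) :
    (M j : ℚ) = T.mean j * D := by
  rw [hM j j.2, mean_eq_column_sum, ← Fin.sum_univ_eq_sum_range
    (fun i => T.input 1 (i * m + j) * (D / T.input 2 (i * m + j))), Finset.sum_mul]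
  push_cast
  refine Finset.sum_congr rfl fun i _ => ?_
  have hd := hdvd i i.2 j j.2
  rw [input_den] at hd
  rw [input_num, input_den, Nat.cast_div hd (by exact_mod_cast (T.p i j).den_ne_zero)]
  have hnum : (((T.p i j).num.toNat : ℕ) : ℚ) = (T.p i j).num := by
    have := Int.toNat_of_nonneg (Rat.num_nonneg.2 (T.nonneg i j))
    exact_mod_cast congrArg (Int.cast : ℤ → ℚ) this
  rw [hnum]
  conv_rhs => rw [← Rat.num_div_den (T.p i j)]
  ring

/-- The final memory is read back as a world. Its integer stuckness inequalities, divided by the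
common denominator, are exactly local optimality. -/
theorem isClosestPossible_output : T.IsClosestPossible (output m (program.run T.input)) := by
  obtain ⟨D, M, hD, hdvd, hM, hw, hs⟩ := program_spec (n := n) (m := m) (σ := T.input)
    (by simp [input]) (by simp [input]) (by simp [input]) (by simp [input])
    (fun i hi => by
      obtain ⟨j, hj⟩ := T.exists_ne_zero ⟨i, hi⟩
      exact ⟨j, j.2, (T.input_num_ne_zero_iff ⟨i, hi⟩ j).2 hj⟩)
    (fun i hi v hv => by
      have := T.input_den ⟨i, hi⟩ ⟨v, hv⟩
      simp only at this
      rw [this]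
      exact (T.p _ _).den_ne_zero)
  set τ := program.run T.input
  let w : Fin n → Fin m := fun i => ⟨τ 4 i, (hw.valid i i.2).1⟩
  have hsup : T.Supported w := fun i =>
    (T.input_num_ne_zero_iff i (w i)).1 (hw.valid i i.2).2
  have hans : answer w = output m τ := by
    funext j
    rw [answer_eq_sum, output, hw.count j j.2, groupCount_eq_sum, ← Fin.sum_univ_eq_sum_range
      (fun i => if τ 4 i = j then 1 else 0)]
    simp [w, Fin.ext_iff]
  rw [← hans]
  refine LocallyOptimal.isClosestPossible hsup fun j k hjk => ?_
  have hmove : ReflTransGen (Move n m (T.input 1) (τ 4)) j k := by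
    refine hjk.lift (fun v : Fin m => (v : ℕ)) ?_
    rintro u v ⟨i, rfl, hi⟩
    exact ⟨i, i.2, v.2, rfl, (T.input_num_ne_zero_iff i v).2 hi⟩
  have hle := hs j j.2 k k.2 hmove
  rw [Improves, not_lt] at hle
  have hj := T.mean_mul_denom hdvd hM j
  have hk := T.mean_mul_denom hdvd hM k
  have hq : ((τ 3 j * D + M k : ℕ) : ℚ) ≤ ((τ 3 k + 1) * D + M j : ℕ) := by exact_mod_cast hle
  push_cast at hq
  rw [hj, hk] at hq
  have hDpos : (0 : ℚ) < D := by exact_mod_cast Nat.pos_of_ne_zero hD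
  have hrj : answer w j = τ 3 j := congrFun hans j
  have hrk : answer w k = τ 3 k := congrFun hans k
  rw [hrj, hrk]
  refine le_of_mul_le_mul_right (a := (D : ℚ)) ?_ hDpos
  linarith

end ProbTable

/-! ### The two claims combined -/

theorem mainTheorem10 :
    (∃ (c : RAM.Cmd) (q : Polynomial ℕ), ∀ (n m : ℕ) (T : ProbTable n m),
      ∃ (σ : RAM.State) (t : ℕ), RAM.Exec c T.input σ t ∧ t ≤ q.eval T.size ∧
        T.IsClosestPossible (ProbTable.output m σ)) ∧
    (∀ (n m : ℕ) (T : ProbTable n m) (r : Fin m → ℕ),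
      T.IsClosestPossible r ↔ ∃ f, T.network.IsMinCostFlow n f ∧ r = T.readOff f) := by
  refine ⟨⟨Rounding.program.compile, Rounding.program.costBound, fun n m T => ?_⟩,
    fun n m T r => T.isClosestPossible_iff_exists_isMinCostFlow r⟩
  have hs := T.add_le_size
  obtain ⟨t, ht, hle⟩ := RAM.Loop.exec_costBound Rounding.program_wellFormed
    (show T.input 0 0 ≤ T.size by simp only [ProbTable.input, if_true]; omega)
    (show T.input 0 1 ≤ T.size by simp [ProbTable.input]; omega) T.input_bounded
  exact ⟨_, t, ht, hle, T.isClosestPossible_output⟩
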